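/- Let $G$ be a finite unicyclic graph (connected, with exactly one cycle) whose cycle $C=v_0v_1\cdots v_{g-1}v_0$ has odd length $g$; indices are read modulo $g$. A vertex $w$ strongly resolves $u\neq v$ if $d(w,u)=d(w,v)+d(v,u)$ or $d(w,v)=d(w,u)+d(u,v)$; a strong metric basis is a smallest vertex set $S$ such that every two distinct vertices are strongly resolved by an element of $S$; a strong basis forced vertex is a vertex that belongs to every strong metric basis of $G$. The strong resolving graph $G_{SR}$ has vertex set $V(G)$, and distinct $u,v$ are adjacent in it if and only if they are mutually maximally distant (MMD): $d(v,w)\le d(v,u)$ for all neighbours $w$ of $u$, and $d(u,w)\le d(u,v)$ for all neighbours $w$ of $v$. A leaf is a vertex of degree one in $G$; the leaves of $u\in C$ are the leaves lying in the component of $G-E(C)$ that contains $u$. A maximal sequence $Q=Q_{[i,j]}$ is a maximal (at both ends) sequence of at least one distinct vertices $v_i, v_{i+(g+1)/2}, v_{i+1}, v_{i+1+(g+1)/2},\dots,v_j$ of $C$, the index increasing by $(g+1)/2$ modulo $g$ at each step, such that each of its vertices has degree $2$ in $G$ and consecutive ones are adjacent in $G_{SR}$. Its end-vertices are $v_i$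 and $v_j$; it is odd or even (of odd or even length) according to its number of vertices; $A_1(Q)$ and $A_2(Q)$ are the sets of every other vertex of $Q$, starting from the first and from the second one, respectively. A leaf is adjacent to $Q$ if it is adjacent in $G_{SR}$ to a vertex of $Q$. Let $U$ be the set of all $u\in C$ with $\deg(u)\ge 3$ whose leaves are not adjacent in $G_{SR}$ to an end-vertex of an odd maximal sequence. Then: (i) If $|U|\ge 2$, or $U=\{u\}$ and the leaves of $u$ are not adjacent to any maximal sequence, then the strong basis forced vertices of $G$ are exactly the leaves of $G$ adjacent to an odd maximal sequence and the vertices of $A_2(Q)$ for all odd maximal sequences $Q$. (ii) If $U=\{u\}$, the leaves of $u$ are adjacent to an even maximal sequence, and $C$ has a vertex other than $u$ of degree at least $3$, then the strong basis forced vertices of $G$ are exactly the leaves of $G$ adjacent to an odd maximal sequence, the vertices of $A_2(Q)$ for all odd maximal sequences $Q$, and the vertices of $A_k(Q)$ for all even maximal sequences $Q$ adjacent to the leaves of $u$, where $k=k(Q)\in\{1,2\}$ is such that the vertex of $Q$ adjacent in $G_{SR}$ to the leaves of $u$ belongs to $A_k(Q)$. (iii) If $U=\emptyset$, then the strong basis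 forced vertices of $G$ are exactly the elements of the set $X$ of the leaves of $G$ adjacent to two (different) odd maximal sequences, and the vertices of $A_2(Q)$ for all odd maximal sequences $Q$ whose two end-vertices are adjacent in $G_{SR}$, respectively, to elements $x_1,x_2\in X$ that are not leaves of a same vertex of $C$. -/

import Mathlib

namespace OddUnicyclic

variable {V : Type*}

/-- A unicyclic graph: connected, with exactly one cycle (cycles being compared as subgraphs,
so that neither base point nor orientation matters). -/
def IsUnicyclic (G : SimpleGraph V) : Prop :=
  G.Connected ∧
    ∃! C : G.Subgraph, ∃ (u : V) (c : G.Walk u u), c.IsCycle ∧ c.toSubgraph = C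

/-- `v 0, v 1, …, v (g - 1)` lists the vertices of a cycle of length `g` of `G` in cyclic order. -/
def IsCycleLabelling (G : SimpleGraph V) (g : ℕ) (v : ZMod g → V) : Prop :=
  3 ≤ g ∧ Function.Injective v ∧ ∀ i : ZMod g, G.Adj (v i) (v (i + 1))

section StrongMetricDimension

/-- `w` strongly resolves `u` and `v`. -/
def StronglyResolves (G : SimpleGraph V) (w u v : V) : Prop :=
  G.dist w u = G.dist w v + G.dist v u ∨ G.dist w v = G.dist w u + G.dist u v

/-- Strong resolving sets. -/
def IsStrongResolvingSet (G : SimpleGraph V) (S : Finset V) : Prop :=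
  ∀ u v : V, u ≠ v → ∃ w ∈ S, StronglyResolves G w u v

/-- The strong metric dimension (of a finite connected graph). -/
noncomputable def strongMetricDim (G : SimpleGraph V) : ℕ :=
  sInf {n : ℕ | ∃ S : Finset V, IsStrongResolvingSet G S ∧ S.card = n}

/-- Strong metric bases: strong resolving sets of smallest cardinality. -/
def IsStrongMetricBasis (G : SimpleGraph V) (S : Finset V) : Prop :=
  IsStrongResolvingSet G S ∧ S.card = strongMetricDim G

/-- The strong basis forced vertices: those that belong to every strong metric basis. -/
def strongBasisForced (G : SimpleGraph V) : Set V :=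
  {x | ∀ S : Finset V, IsStrongMetricBasis G S → x ∈ S}

/-- `u` is maximally distant from `v`. -/
def MaximallyDistant (G : SimpleGraph V) (u v : V) : Prop :=
  ∀ w : V, G.Adj u w → G.dist v w ≤ G.dist v u

/-- The strong resolving graph `G_SR`: distinct vertices are adjacent if and only if they are
mutually maximally distant in `G`. -/
def strongResolvingGraph (G : SimpleGraph V) : SimpleGraph V where
  Adj u v := u ≠ v ∧ MaximallyDistant G u v ∧ MaximallyDistant G v u
  symm := ⟨fun _ _ h => ⟨h.1.symm, h.2.2, h.2.1⟩⟩
  loopless := ⟨fun _ h => h.1 rfl⟩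

end StrongMetricDimension

/-- The edge set of the labelled cycle. -/
def cycleEdges {g : ℕ} (v : ZMod g → V) : Set (Sym2 V) :=
  Set.range fun i : ZMod g => s(v i, v (i + 1))

/-- The `k`-th term (counted from `0`) of the sequence
`v_i, v_{i+(g+1)/2}, v_{i+1}, v_{i+1+(g+1)/2}, v_{i+2}, …` (`g` odd): every step adds `(g+1)/2`
to the index modulo `g`, so that two steps add `1`. -/
def seqTerm {g : ℕ} (v : ZMod g → V) (i : ZMod g) (k : ℕ) : V :=
  v (i + (k : ZMod g) * (((g + 1) / 2 : ℕ) : ZMod g))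

section Sequences

variable [Fintype V] (G : SimpleGraph V) [DecidableRel G.Adj] {g : ℕ} (v : ZMod g → V)

/-- The leaves of the cycle vertex `u`: the vertices of degree one of `G` that lie in the
component `T_u` of `G - E(C)` containing `u`. -/
def leavesAt (u : V) : Set V :=
  {x | G.degree x = 1 ∧ (G.deleteEdges (cycleEdges v)).Reachable u x}

/-- The `q ≥ 1` vertices starting with `v i` are distinct, all have degree two in `G`, and
consecutive ones are adjacent in `G_SR`. -/
def IsSequence (i : ZMod g) (q : ℕ) : Prop :=
  1 ≤ q ∧ q ≤ g ∧ (∀ k < q, G.degree (seqTerm v i k) = 2) ∧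
    ∀ k, k + 1 < q → (strongResolvingGraph G).Adj (seqTerm v i k) (seqTerm v i (k + 1))

/-- Maximal sequences `Q` (first vertex `v i`, `q` vertices): they can be prolonged neither at
the end nor at the beginning. -/
def IsMaximalSequence (i : ZMod g) (q : ℕ) : Prop :=
  IsSequence G v i q ∧ ¬ IsSequence G v i (q + 1) ∧
    ¬ IsSequence G v (i - (((g + 1) / 2 : ℕ) : ZMod g)) (q + 1)

/-- `A_r(Q)`, `r = 1, 2`: every other vertex of the sequence, beginning with the `r`-th one. -/
def altVertices (r : ℕ) (i : ZMod g) (q : ℕ) : Set V :=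
  {y | ∃ k < q, k % 2 + 1 = r ∧ seqTerm v i k = y}

/-- `x` is adjacent in `G_SR` to (some vertex of) the sequence. -/
def AdjToSequence (x : V) (i : ZMod g) (q : ℕ) : Prop :=
  ∃ k < q, (strongResolvingGraph G).Adj x (seqTerm v i k)

/-- The set `U`: the cycle vertices of degree at least three whose leaves are not adjacent in
`G_SR` to an end-vertex of a maximal sequence of odd length. -/
def setU : Set V :=
  {u | u ∈ Set.range v ∧ 3 ≤ G.degree u ∧
    ∀ x ∈ leavesAt G v u, ∀ i q, IsMaximalSequence G v i q → Odd q →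
      ¬ (strongResolvingGraph G).Adj x (seqTerm v i 0) ∧
      ¬ (strongResolvingGraph G).Adj x (seqTerm v i (q - 1))}

/-- The leaves of `G` adjacent in `G_SR` to a maximal sequence of odd length. -/
def oddLeaves : Set V :=
  {x | G.degree x = 1 ∧ ∃ i q, IsMaximalSequence G v i q ∧ Odd q ∧ AdjToSequence G v x i q}

/-- The union of the sets `A_2(Q)` over all maximal sequences `Q` of odd length. -/
def oddAlt : Set V :=
  {y | ∃ i q, IsMaximalSequence G v i q ∧ Odd q ∧ y ∈ altVertices v 2 i q}

/-- The union, over all maximal sequences `Q` of even length adjacent in `G_SR` to the leaves of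
`u`, of `A_k(Q)`, where `k ∈ {1, 2}` is such that `A_k(Q)` contains the vertex of `Q` adjacent in
`G_SR` to the leaves of `u`. -/
def evenAltAt (u : V) : Set V :=
  {y | ∃ i q, IsMaximalSequence G v i q ∧ Even q ∧ ∃ k, (k = 1 ∨ k = 2) ∧
    (∃ x ∈ leavesAt G v u, ∃ z ∈ altVertices v k i q, (strongResolvingGraph G).Adj x z) ∧
    y ∈ altVertices v k i q}

/-- The set `X`: the leaves of `G` adjacent in `G_SR` to two maximal sequences of odd length. -/
def setX : Set V :=
  {x | G.degree x = 1 ∧ ∃ i q i' q', (i, q) ≠ (i', q') ∧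
    IsMaximalSequence G v i q ∧ Odd q ∧ AdjToSequence G v x i q ∧
    IsMaximalSequence G v i' q' ∧ Odd q' ∧ AdjToSequence G v x i' q'}

/-- The union of the sets `A_2(Q)` over the maximal sequences `Q` of odd length whose two
end-vertices are adjacent in `G_SR` to two elements `x₁` and `x₂` of `X`, respectively, that are
not leaves of a same cycle vertex. -/
def oddAltBetweenX : Set V :=
  {y | ∃ i q, IsMaximalSequence G v i q ∧ Odd q ∧
    (∃ x₁ ∈ setX G v, ∃ x₂ ∈ setX G v,
      (strongResolvingGraph G).Adj (seqTerm v i 0) x₁ ∧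
      (strongResolvingGraph G).Adj (seqTerm v i (q - 1)) x₂ ∧
      ¬ ∃ j : ZMod g, x₁ ∈ leavesAt G v (v j) ∧ x₂ ∈ leavesAt G v (v j)) ∧
    y ∈ altVertices v 2 i q}

end Sequences

end OddUnicyclic

open OddUnicyclic

-- A vertex strongly resolves a mutually maximally distant pair only if it belongs to the pair, and
-- every other pair lies on a geodesic joining such a pair. Hence strong metric bases are the
-- minimum vertex covers of the strong resolving graph, and the forced vertices are those lying in
-- no maximum independent set (`mem_strongBasisForced_iff`).
--
-- The strong resolving graph is explicit (`cyclicModel`). Order the cycle by steps of (g+1)/2, so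
-- that consecutive vertices are antipodal. The vertices of degree at least 3 (positions `B`) cut
-- this circular order into runs of degree-2 vertices, and each run is a path. The leaves form a
-- clique, and a leaf rooted at position b is adjacent to the run vertices at b + 1 and b - 1, if
-- any. All other vertices are isolated. The maximal sequences are the runs, provided `B` is
-- nonempty.
--
-- An independent set therefore has at most one leaf and at most ⌈q/2⌉ vertices of a run of length
-- q. In an odd run only A_1 attains this bound, so avoiding an end, or using a vertex of A_2, loses
-- one vertex. An even run can avoid either chosen end at no loss, and the choice then determines
-- the set completely.
--
-- If `U` is nonempty and `B` has a second element, a leaf at `U` is gained for free. Every maximum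
-- set then has such a leaf and loses nothing in the runs, which forces the leaves beside odd runs
-- and the sets A_2 of odd runs. If moreover `U = {u}`, the even runs beside u are rigid too
-- (`forced_iff_of_mem_evenPositions`).
--
-- If `U` is empty, every leaf costs at least the one vertex it brings. A maximum set either has no
-- leaf and no loss, or has a leaf beside exactly one odd run and loses one vertex there
-- (`forced_iff_of_evenPositions_eq_empty`).

namespace OddUnicyclic

variable {V : Type*}

-- Vertex covers of the strong resolving graph, and distances across bridges

section General

variable {G : SimpleGraph V}

/-- Otherwise the first step of a geodesic from `v` to `w` would lead to a neighbour of `v` farther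
from `u`. Hence a mutually maximally distant pair is resolved only by its own members. -/
theorem eq_of_maximallyDistant (hG : G.Connected) {u v w : V} (hv : MaximallyDistant G v u)
    (h : G.dist w u = G.dist w v + G.dist v u) : w = v := by
  by_contra hne
  obtain ⟨p, hp⟩ := hG.exists_walk_length_eq_dist v w
  cases p with
  | nil => exact hne rfl
  | cons hadj q =>
    rename_i z
    have h1 := G.dist_le q
    have h2 := hv z hadj
    have h3 := hG.dist_triangle (u := w) (v := z) (w := u)
    rw [SimpleGraph.Walk.length_cons] at hp
    rw [G.dist_comm (u := z) (v := w)] at h1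
    rw [G.dist_comm (u := v) (v := w)] at hp
    rw [G.dist_comm (u := u) (v := z), G.dist_comm (u := u) (v := v)] at h2
    omega

/-- Prolong a geodesic from `u` to `v` at both ends as far as possible: a neighbour of an end
farther from the other end would prolong it again. -/
theorem exists_adj_strongResolvingGraph [Finite V] (hG : G.Connected) {u v : V} (huv : u ≠ v) :
    ∃ a b, (strongResolvingGraph G).Adj a b ∧
      G.dist a b = G.dist a u + G.dist u v + G.dist v b := by
  classical
  have hfin : Set.Finite {p : V × V | G.dist p.1 p.2 = G.dist p.1 u + G.dist u v + G.dist v p.2} :=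
    Set.toFinite _
  obtain ⟨⟨a, b⟩, hab, hmax⟩ := hfin.exists_maximalFor (fun p : V × V => G.dist p.1 p.2) _
    ⟨(u, v), by simp⟩
  simp only [Set.mem_ofPred_eq] at hab
  have hpos := hG.pos_dist_of_ne huv
  refine ⟨a, b, ⟨?_, ?_, ?_⟩, hab⟩
  · rintro rfl
    rw [G.dist_self] at hab
    omega
  · intro w hw
    by_contra hlt
    have h1 : G.dist w a = 1 := SimpleGraph.dist_eq_one_iff_adj.2 hw.symm
    have h2 := hG.dist_triangle (u := w) (v := a) (w := u)
    have h3 := hG.dist_triangle (u := w) (v := u) (w := b)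
    have h4 := hG.dist_triangle (u := u) (v := v) (w := b)
    rw [G.dist_comm (u := b) (v := w), G.dist_comm (u := b) (v := a)] at hlt
    have h5 := @hmax (w, b) (by simp only [Set.mem_ofPred_eq]; omega) (by dsimp only; omega)
    dsimp only at h5
    omega
  · intro w hw
    by_contra hlt
    have h1 : G.dist b w = 1 := SimpleGraph.dist_eq_one_iff_adj.2 hw
    have h2 := hG.dist_triangle (u := v) (v := b) (w := w)
    have h3 := hG.dist_triangle (u := a) (v := v) (w := w)
    have h4 := hG.dist_triangle (u := a) (v := u) (w := v)
    have h5 := @hmax (a, w) (by simp only [Set.mem_ofPred_eq]; omega) (by dsimp only; omega)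
    dsimp only at h5
    omega

/-- Strong resolving sets are the vertex covers of the strong resolving graph. -/
theorem isStrongResolvingSet_iff [Finite V] (hG : G.Connected) (S : Finset V) :
    IsStrongResolvingSet G S ↔ ∀ u v, (strongResolvingGraph G).Adj u v → u ∈ S ∨ v ∈ S := by
  constructor
  · rintro h u v ⟨hne, huv, hvu⟩
    obtain ⟨w, hw, h1 | h1⟩ := h u v hne
    · exact Or.inr (eq_of_maximallyDistant hG hvu h1 ▸ hw)
    · exact Or.inl (eq_of_maximallyDistant hG huv h1 ▸ hw)
  · intro h u v hne
    obtain ⟨a, b, hab, hd⟩ := exists_adj_strongResolvingGraph hG hne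
    have h3 := hG.dist_triangle (u := a) (v := u) (w := b)
    have h4 := hG.dist_triangle (u := u) (v := v) (w := b)
    have h5 := hG.dist_triangle (u := a) (v := v) (w := b)
    have h6 := hG.dist_triangle (u := a) (v := u) (w := v)
    rcases h a b hab with ha | hb
    · exact ⟨a, ha, Or.inr (by omega)⟩
    · refine ⟨b, hb, Or.inl ?_⟩
      rw [G.dist_comm (u := b), G.dist_comm (u := b), G.dist_comm (u := v) (v := u)]
      omega

theorem isIndepSet_compl_iff [Fintype V] [DecidableEq V] (hG : G.Connected) (S : Finset V) :
    (strongResolvingGraph G).IsIndepSet (Sᶜ : Finset V) ↔ IsStrongResolvingSet G S := by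
  rw [isStrongResolvingSet_iff hG]
  constructor
  · intro h u v huv
    by_contra hc
    push Not at hc
    exact h (by simpa using hc.1) (by simpa using hc.2) huv.ne huv
  · intro h u hu v hv _ huv
    simp only [Finset.coe_compl, Set.mem_compl_iff, Finset.mem_coe] at hu hv
    rcases h u v huv with h1 | h1 <;> contradiction

/-- The forced vertices are those in no maximum independent set of the strong resolving graph. -/
theorem mem_strongBasisForced_iff [Fintype V] (hG : G.Connected) (x : V) :
    x ∈ strongBasisForced G ↔
      ∀ I : Finset V, (strongResolvingGraph G).IsMaximumIndepSet I → x ∉ I := by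
  classical
  have key : ∀ S : Finset V,
      IsStrongMetricBasis G S ↔ (strongResolvingGraph G).IsMaximumIndepSet Sᶜ := by
    intro S
    unfold IsStrongMetricBasis strongMetricDim
    rw [← isIndepSet_compl_iff hG]
    constructor
    · rintro ⟨h1, h2⟩
      refine ⟨h1, fun T hT => ?_⟩
      have h3 : IsStrongResolvingSet G Tᶜ := by
        rw [← isIndepSet_compl_iff hG, compl_compl]
        exact hT
      have h4 : S.card ≤ (Tᶜ).card := by
        rw [h2]
        exact Nat.sInf_le ⟨_, h3, rfl⟩
      rw [Finset.card_compl] at *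
      have := Finset.card_le_univ T
      have := Finset.card_le_univ S
      omega
    · intro h
      refine ⟨h.1, le_antisymm ?_ (Nat.sInf_le ⟨S, (isIndepSet_compl_iff hG S).1 h.1, rfl⟩)⟩
      refine le_csInf ⟨_, S, (isIndepSet_compl_iff hG S).1 h.1, rfl⟩ ?_
      rintro n ⟨T, hT, rfl⟩
      have h4 := h.2 Tᶜ ((isIndepSet_compl_iff hG T).2 hT)
      rw [Finset.card_compl, Finset.card_compl] at h4
      have := Finset.card_le_univ T
      have := Finset.card_le_univ S
      omega
  constructor
  · intro h I hI hx
    have := h Iᶜ ((key _).2 (by rwa [compl_compl]))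
    simp [hx] at this
  · intro h S hS
    have := h Sᶜ ((key S).1 hS)
    simpa using this

/-- At the end `x` of a bridge `xw`, all neighbours other than `w` lead away from the vertices on
the side of `w`. -/
theorem dist_lt_of_isBridge (hG : G.Connected) {x w w' y : V}
    (hb : G.IsBridge s(x, w)) (hw' : G.Adj x w') (hne : w' ≠ w)
    (h : G.dist y w ≤ G.dist y x) : G.dist y x < G.dist y w' := by
  classical
  by_contra hle
  rw [not_lt] at hle
  -- A geodesic from `y` using the bridge passes through `x` before its end `z`, so `z` would be
  -- farther from `y` than `x`. With `w` and `w'` both reached off the bridge, the edge `xw'` joins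
  -- `x` to `w` without it.
  have avoid : ∀ z, z ≠ x → G.dist y z ≤ G.dist y x →
      (G.deleteEdges {s(x, w)}).Reachable y z := by
    intro z hz hd
    obtain ⟨p, hp⟩ := hG.exists_walk_length_eq_dist y z
    rw [SimpleGraph.reachable_deleteEdges_iff_exists_walk]
    refine ⟨p, fun hmem => ?_⟩
    have hx : x ∈ p.support := p.fst_mem_support_of_mem_edges hmem
    have h1 := G.dist_le (p.takeUntil x hx)
    have h2 := p.length_takeUntil_lt_length hx hz.symm
    omega
  refine SimpleGraph.isBridge_iff.1 hb ?_
  have hadj : G.Adj x w := by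
    by_contra hn
    exact hn ((hb.reachable_iff_adj).1 (hG x w))
  have h1 := avoid w hadj.ne' h
  have h2 := avoid w' hw'.ne' hle
  have h3 : (G.deleteEdges {s(x, w)}).Adj x w' := by
    rw [SimpleGraph.deleteEdges_adj]
    refine ⟨hw', ?_⟩
    simp only [Set.mem_singleton_iff, Sym2.eq_iff, not_or]
    exact ⟨fun h => hne h.2, fun h => hadj.ne h.1⟩
  exact h3.reachable.trans (h2.symm.trans h1)

/-- Either the far end of the bridge is farther from `y`, or `y` is on that side and every other
neighbour is farther. -/
theorem not_maximallyDistant_of_isBridge (hG : G.Connected) {x w w' : V}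
    (hb : G.IsBridge s(x, w)) (hw : G.Adj x w) (hw' : G.Adj x w') (hne : w' ≠ w) (y : V) :
    ¬ MaximallyDistant G x y := by
  intro h
  exact absurd (h w' hw') (not_le.2 (dist_lt_of_isBridge hG hb hw' hne (h w hw)))

theorem maximallyDistant_of_subsingleton (hG : G.Connected) {x y : V} (hne : x ≠ y)
    (hx : ∀ a b, G.Adj x a → G.Adj x b → a = b) : MaximallyDistant G x y := by
  intro w hw
  obtain ⟨p, hp⟩ := hG.exists_walk_length_eq_dist x y
  cases p with
  | nil => exact absurd rfl hne
  | cons hadj q =>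
    rename_i z
    have h1 := G.dist_le q
    rw [SimpleGraph.Walk.length_cons] at hp
    rw [hx w z hw hadj, G.dist_comm, G.dist_comm (u := y)]
    omega

end General
end OddUnicyclic

namespace OddUnicyclic

variable {V : Type*}

-- The cycle, the trees attached to it, and distances from cycle vertices

section Structure

variable {G : SimpleGraph V} {g : ℕ} {v : ZMod g → V}

theorem natCast_ne_zero_of_lt {n : ℕ} (h0 : 0 < n) (h : n < g) : (n : ZMod g) ≠ 0 := by
  rw [Ne, ZMod.natCast_eq_zero_iff]
  exact Nat.not_dvd_of_pos_of_lt h0 h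

theorem reachable_arc (K : SimpleGraph V) (a : ZMod g) (n : ℕ)
    (h : ∀ k < n, K.Adj (v (a + (k : ℕ))) (v (a + (k : ℕ) + 1))) :
    K.Reachable (v a) (v (a + (n : ℕ))) := by
  induction n with
  | zero => simp
  | succ n ih =>
    refine (ih fun k hk => h k (by omega)).trans ?_
    have := (h n (by omega)).reachable
    rwa [add_assoc, ← Nat.cast_succ] at this

/-- Equality with the ends swapped would give 2 = 0 modulo `g`, which `3 ≤ g` excludes. -/
theorem cycleEdge_injective (hv : IsCycleLabelling G g v) {i j : ZMod g}
    (h : s(v i, v (i + 1)) = s(v j, v (j + 1))) : i = j := by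
  rw [Sym2.eq_iff] at h
  rcases h with ⟨h, -⟩ | ⟨h1, h2⟩
  · exact hv.2.1 h
  · have h1 := hv.2.1 h1
    have h2 := hv.2.1 h2
    have h3 : ((2 : ℕ) : ZMod g) = 0 := by
      push_cast
      linear_combination h2 - h1
    exact absurd h3 (natCast_ne_zero_of_lt (by omega) (by have := hv.1; omega))

theorem reachable_delete_cycleEdge (hv : IsCycleLabelling G g v) (K : SimpleGraph V)
    (hK : ∀ i, K.Adj (v i) (v (i + 1))) (j : ZMod g) :
    (K.deleteEdges {s(v j, v (j + 1))}).Reachable (v j) (v (j + 1)) := by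
  have hg := hv.1
  have h := reachable_arc (v := v) (K.deleteEdges {s(v j, v (j + 1))}) (j + 1) (g - 1) ?_
  · rw [Nat.cast_sub (by omega)] at h
    simpa using h.symm
  · intro k hk
    rw [SimpleGraph.deleteEdges_adj]
    refine ⟨hK _, fun h => ?_⟩
    have h1 := cycleEdge_injective hv h
    refine natCast_ne_zero_of_lt (g := g) (n := k + 1) (by omega) (by omega) ?_
    push_cast
    linear_combination h1

/-- The rest of the labelled cycle bypasses the edge, so the edge is not a bridge. The graph `K` is
arbitrary so that this also applies to `G` with an edge removed. -/
theorem exists_isCycle_cycleEdge_mem (hv : IsCycleLabelling G g v) (K : SimpleGraph V)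
    (hK : ∀ i, K.Adj (v i) (v (i + 1))) (j : ZMod g) :
    ∃ (u : V) (c : K.Walk u u), c.IsCycle ∧ s(v j, v (j + 1)) ∈ c.edges := by
  have h := (SimpleGraph.isBridge_iff_forall_cycle_notMem (G := K)
    (e := s(v j, v (j + 1))) (hK j)).not.1
      (fun hb => SimpleGraph.isBridge_iff.1 hb (reachable_delete_cycleEdge hv K hK j))
  push Not at h
  obtain ⟨u, c, hc, he⟩ := h
  exact ⟨u, c, hc, he⟩

theorem IsUnicyclic.mem_edges (hG : IsUnicyclic G) {u u' : V} {c : G.Walk u u} {c' : G.Walk u' u'}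
    (hc : c.IsCycle) (hc' : c'.IsCycle) {e : Sym2 V} (he : e ∈ c.edges) : e ∈ c'.edges := by
  have h := hG.2.unique ⟨u, c, hc, rfl⟩ ⟨u', c', hc', rfl⟩
  rw [← SimpleGraph.Walk.mem_edges_toSubgraph] at he ⊢
  rwa [← h]

/-- Edges outside the cycle are bridges. -/
theorem isBridge_of_notMem_cycleEdges (hG : IsUnicyclic G) (hv : IsCycleLabelling G g v)
    {x y : V} (hxy : G.Adj x y) (he : s(x, y) ∉ cycleEdges v) : G.IsBridge s(x, y) := by
  rw [SimpleGraph.isBridge_iff_forall_cycle_notMem hxy]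
  intro u c hc hmem
  have hle : G.deleteEdges {s(x, y)} ≤ G := G.deleteEdges_le _
  -- The labelled cycle survives the deletion of `xy`, so some cycle avoids `xy`; by uniqueness no
  -- cycle contains it.
  obtain ⟨u', c', hc', -⟩ := exists_isCycle_cycleEdge_mem hv (G.deleteEdges {s(x, y)})
    (fun i => by
      rw [SimpleGraph.deleteEdges_adj]
      exact ⟨hv.2.2 i, fun h => he ⟨i, h⟩⟩) 0
  have h1 := hG.mem_edges hc (hc'.mapLe hle) hmem
  rw [SimpleGraph.Walk.edges_mapLe_eq_edges] at h1
  have h2 := c'.edges_subset_edgeSet h1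
  simp at h2

theorem adj_or_deleteEdges_adj {x y : V} (h : G.Adj x y) :
    (G.deleteEdges (cycleEdges v)).Adj x y ∨ ∃ i, (x = v i ∧ y = v (i + 1)) ∨
      (y = v i ∧ x = v (i + 1)) := by
  by_cases hc : s(x, y) ∈ cycleEdges v
  · obtain ⟨i, hi⟩ := hc
    simp only [Sym2.eq_iff] at hi
    right
    refine ⟨i, ?_⟩
    rcases hi with ⟨h1, h2⟩ | ⟨h1, h2⟩
    · exact Or.inl ⟨h1.symm, h2.symm⟩
    · exact Or.inr ⟨h1.symm, h2.symm⟩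
  · left
    rw [SimpleGraph.deleteEdges_adj]
    exact ⟨h, hc⟩

/-- Trees attached at distinct cycle vertices are disjoint. Deleting the cycle edge at `j` destroys
the only cycle, so the cycle edge at `i` becomes a bridge. A connection from `v i` to `v j` off the
cycle, followed by the arc back to `v (i + 1)`, would bypass it. -/
theorem eq_of_reachable (hG : IsUnicyclic G) (hv : IsCycleLabelling G g v) {i j : ZMod g}
    (h : (G.deleteEdges (cycleEdges v)).Reachable (v i) (v j)) : i = j := by
  by_contra hij
  have hg := hv.1
  have : NeZero g := ⟨by omega⟩
  set K := G.deleteEdges {s(v j, v (j + 1))} with hK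
  have hbr : K.IsBridge s(v i, v (i + 1)) := by
    have hadj : K.Adj (v i) (v (i + 1)) := by
      rw [hK, SimpleGraph.deleteEdges_adj]
      exact ⟨hv.2.2 i, fun h => hij (cycleEdge_injective hv h)⟩
    rw [SimpleGraph.isBridge_iff_forall_cycle_notMem hadj]
    intro u c hc _
    have hle : K ≤ G := G.deleteEdges_le _
    obtain ⟨u', c', hc', hm⟩ := exists_isCycle_cycleEdge_mem hv G hv.2.2 j
    have h1 := hG.mem_edges hc' (hc.mapLe hle) hm
    rw [SimpleGraph.Walk.edges_mapLe_eq_edges] at h1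
    have h2 := c.edges_subset_edgeSet h1
    simp [hK] at h2
  refine SimpleGraph.isBridge_iff.1 hbr ?_
  have hle : G.deleteEdges (cycleEdges v) ≤ K.deleteEdges {s(v i, v (i + 1))} := by
    rw [hK, SimpleGraph.deleteEdges_deleteEdges]
    refine SimpleGraph.deleteEdges_anti ?_
    rintro e (rfl | rfl)
    · exact ⟨j, rfl⟩
    · exact ⟨i, rfl⟩
  refine (h.mono hle).trans ?_
  have harc := reachable_arc (v := v) (K.deleteEdges {s(v i, v (i + 1))}) (i + 1)
    (j - (i + 1)).val ?_
  · rw [ZMod.natCast_zmod_val] at harc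
    simpa using harc.symm
  · intro k hk
    have hkg : k + 1 < g := Nat.lt_of_le_of_lt hk (ZMod.val_lt _)
    rw [SimpleGraph.deleteEdges_adj, hK, SimpleGraph.deleteEdges_adj]
    refine ⟨⟨hv.2.2 _, fun h => ?_⟩, fun h => ?_⟩
    · have h1 := cycleEdge_injective hv h
      have h2 : j - (i + 1) = (k : ZMod g) := by linear_combination -h1
      rw [h2, ZMod.val_natCast, Nat.mod_eq_of_lt (by omega)] at hk
      omega
    · have h1 := cycleEdge_injective hv h
      refine natCast_ne_zero_of_lt (g := g) (n := k + 1) (by omega) hkg ?_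
      push_cast
      linear_combination h1

theorem exists_reachable (hG : G.Connected) (v : ZMod g → V) (x : V) :
    ∃ i, (G.deleteEdges (cycleEdges v)).Reachable (v i) x := by
  obtain ⟨p⟩ := hG (v 0) x
  suffices h : ∀ {a b : V} (p : G.Walk a b),
      (∃ i, (G.deleteEdges (cycleEdges v)).Reachable (v i) a) →
      ∃ i, (G.deleteEdges (cycleEdges v)).Reachable (v i) b from h p ⟨0, .refl _⟩
  intro a b p
  induction p with
  | nil => exact id
  | cons hadj _ ih =>
    rintro ⟨i, hi⟩
    apply ih
    rcases adj_or_deleteEdges_adj (v := v) hadj with h | ⟨j, ⟨-, rfl⟩ | ⟨rfl, -⟩⟩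
    · exact ⟨i, hi.trans h.reachable⟩
    · exact ⟨j + 1, .refl _⟩
    · exact ⟨j, .refl _⟩

/-- The cycle vertex at which the tree containing `x` is attached. -/
noncomputable def root (hG : G.Connected) (v : ZMod g → V) (x : V) : ZMod g :=
  (exists_reachable hG v x).choose

theorem root_reachable (hG : G.Connected) (v : ZMod g → V) (x : V) :
    (G.deleteEdges (cycleEdges v)).Reachable (v (root hG v x)) x :=
  (exists_reachable hG v x).choose_spec

theorem root_eq (hG : IsUnicyclic G) (hv : IsCycleLabelling G g v) {i : ZMod g} {x : V}
    (h : (G.deleteEdges (cycleEdges v)).Reachable (v i) x) : root hG.1 v x = i :=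
  eq_of_reachable hG hv ((root_reachable hG.1 v x).trans h.symm)

theorem dist_cycle_le (hv : IsCycleLabelling G g v) (hG : G.Connected) (i : ZMod g) (m : ℕ) :
    G.dist (v i) (v (i + (m : ℕ))) ≤ m := by
  induction m with
  | zero => simp
  | succ m ih =>
    have h1 := hG.dist_triangle (u := v i) (v := v (i + (m : ℕ))) (w := v (i + (m + 1 : ℕ)))
    have h2 : G.dist (v (i + (m : ℕ))) (v (i + (m + 1 : ℕ))) = 1 := by
      rw [SimpleGraph.dist_eq_one_iff_adj]
      have := hv.2.2 (i + (m : ℕ))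
      rwa [add_assoc, ← Nat.cast_succ] at this
    omega

theorem natAbs_valMinAbs_one [NeZero g] : ((1 : ZMod g).valMinAbs).natAbs ≤ 1 := by
  rw [ZMod.valMinAbs_natAbs_eq_min]
  have := ZMod.val_one'' (n := g)
  by_cases h : g = 1
  · subst h; decide
  · rw [this h]; exact min_le_left _ _

theorem natAbs_valMinAbs_add_one_le [NeZero g] (a b : ZMod g) (h : b = a + 1 ∨ a = b + 1) :
    b.valMinAbs.natAbs ≤ a.valMinAbs.natAbs + 1 := by
  have h1 := natAbs_valMinAbs_one (g := g)
  rcases h with rfl | rfl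
  · have := ZMod.natAbs_valMinAbs_add_le a 1
    have := Int.natAbs_add_le a.valMinAbs (1 : ZMod g).valMinAbs
    omega
  · have := ZMod.natAbs_valMinAbs_add_le (b + 1) (-1)
    have h3 := Int.natAbs_add_le (b + 1).valMinAbs (-1 : ZMod g).valMinAbs
    rw [ZMod.natAbs_valMinAbs_neg] at h3
    rw [add_neg_cancel_right] at this
    omega

/-- The right side is cyclic distance to the root plus distance inside the tree. It bounds the
distance from above by concatenation. It bounds it from below because, as a function of `x`, it
vanishes at `v b` and grows by at most 1 along each edge. -/
theorem dist_eq (hG : IsUnicyclic G) (hv : IsCycleLabelling G g v) (b : ZMod g) (x : V) :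
    G.dist (v b) x = ((root hG.1 v x - b).valMinAbs).natAbs +
      (G.deleteEdges (cycleEdges v)).dist (v (root hG.1 v x)) x := by
  have hg := hv.1
  have : NeZero g := ⟨by omega⟩
  set H := G.deleteEdges (cycleEdges v) with hH
  have hle : H ≤ G := G.deleteEdges_le _
  set f : V → ℕ := fun y => ((root hG.1 v y - b).valMinAbs).natAbs +
    H.dist (v (root hG.1 v y)) y with hf
  have hroot : ∀ i, root hG.1 v (v i) = i := fun i => root_eq hG hv (.refl _)
  have hfv : ∀ i, f (v i) = ((i - b).valMinAbs).natAbs := by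
    intro i
    simp [hf, hroot]
  have hlip : ∀ y z, G.Adj y z → f z ≤ f y + 1 := by
    intro y z hyz
    rcases adj_or_deleteEdges_adj (v := v) hyz with h | ⟨j, ⟨rfl, rfl⟩ | ⟨rfl, rfl⟩⟩
    · have hr : root hG.1 v z = root hG.1 v y :=
        root_eq hG hv ((root_reachable hG.1 v y).trans h.reachable)
      simp only [hf, hr]
      have h1 : H.dist (v (root hG.1 v y)) z ≤ H.dist (v (root hG.1 v y)) y + H.dist y z :=
        (root_reachable hG.1 v y).dist_triangle_left z
      have h2 : H.dist y z = 1 := SimpleGraph.dist_eq_one_iff_adj.2 h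
      omega
    · rw [hfv, hfv]
      exact natAbs_valMinAbs_add_one_le _ _ (Or.inl (by ring))
    · rw [hfv, hfv]
      exact natAbs_valMinAbs_add_one_le _ _ (Or.inr (by ring))
  apply le_antisymm
  · have h1 := hG.1.dist_triangle (u := v b) (v := v (root hG.1 v x)) (w := x)
    have h2 := SimpleGraph.Reachable.dist_anti hle (root_reachable hG.1 v x)
    have h3 : G.dist (v b) (v (root hG.1 v x)) ≤ ((root hG.1 v x - b).valMinAbs).natAbs := by
      set r := root hG.1 v x
      have hc := ZMod.coe_valMinAbs (r - b)
      -- The sign of the least absolute residue tells which way round the cycle is shorter.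
      rcases Int.natAbs_eq (r - b).valMinAbs with h | h
      · rw [h, Int.cast_natCast] at hc
        have h4 := dist_cycle_le hv hG.1 b (r - b).valMinAbs.natAbs
        rwa [show b + (((r - b).valMinAbs.natAbs : ℕ) : ZMod g) = r by
          linear_combination hc] at h4
      · rw [h, Int.cast_neg, Int.cast_natCast] at hc
        have h4 := dist_cycle_le hv hG.1 r (r - b).valMinAbs.natAbs
        rwa [show r + (((r - b).valMinAbs.natAbs : ℕ) : ZMod g) = b by
          linear_combination -hc, G.dist_comm] at h4
    omega
  · obtain ⟨p, hp⟩ := hG.1.exists_walk_length_eq_dist (v b) x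
    rw [← hp]
    suffices h : ∀ {y z : V} (p : G.Walk y z), f z ≤ f y + p.length by
      have := h p
      rw [hfv b, sub_self] at this
      simpa using this
    intro y z p
    induction p with
    | nil => simp
    | cons hadj q ih =>
      have := hlip _ _ hadj
      rw [SimpleGraph.Walk.length_cons]
      omega

end Structure

end OddUnicyclic

namespace OddUnicyclic

variable {V : Type*}

/-- The strong resolving graph of an odd unicyclic graph, with the cycle vertices in the order
`w 0, w 1, …` in which consecutive vertices are antipodal: `B` holds the positions of the vertices
of degree at least three, `L` the leaves, and `P x` is the position of the cycle vertex at which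
the leaf `x` hangs. -/
structure CyclicModel (S : SimpleGraph V) {g : ℕ} (w : ZMod g → V) (B : Set (ZMod g)) (L : Set V)
    (P : V → ZMod g) : Prop where
  injective : Function.Injective w
  leaf_adj_leaf : ∀ {x y}, x ∈ L → y ∈ L → x ≠ y → S.Adj x y
  leaf_adj_iff : ∀ {x p}, x ∈ L → p ∉ B → (S.Adj x (w p) ↔ p = P x + 1 ∨ p = P x - 1)
  adj_iff : ∀ {p q}, p ∉ B → q ∉ B → (S.Adj (w p) (w q) ↔ q = p + 1 ∨ p = q + 1)
  mem_of_adj : ∀ {x y}, S.Adj x y → x ∈ L ∨ ∃ p, p ∉ B ∧ w p = x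
  root_mem : ∀ {x}, x ∈ L → P x ∈ B
  exists_leaf : ∀ {b}, b ∈ B → ∃ x ∈ L, P x = b
  leaf_ne : ∀ {x p}, x ∈ L → w p ≠ x

-- The antipodal order of an odd cycle

section Antipodal

variable {g : ℕ}

/-- As (g+1)/2 is the inverse of 2, the cycle index `i` sits at position `2 * i` of the antipodal
order. -/
theorem two_mul_half (hg : Odd g) : (2 : ZMod g) * (((g + 1) / 2 : ℕ) : ZMod g) = 1 := by
  have h : 2 * ((g + 1) / 2) = g + 1 := by
    obtain ⟨n, rfl⟩ := hg
    omega
  have := congrArg (Nat.cast (R := ZMod g)) h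
  push_cast at this
  simpa using this

/-- With g = 2n + 1, cyclic distance is at most n, and below n a step away from 0 increases it. The
local maxima are thus ±n, which are ∓(g+1)/2 modulo g. -/
theorem natAbs_valMinAbs_isMax_iff (hg : Odd g) (a : ZMod g) :
    ((a + 1).valMinAbs.natAbs ≤ a.valMinAbs.natAbs ∧
      (a - 1).valMinAbs.natAbs ≤ a.valMinAbs.natAbs) ↔
    (a = (((g + 1) / 2 : ℕ) : ZMod g) ∨ a = -(((g + 1) / 2 : ℕ) : ZMod g)) := by
  obtain ⟨n, rfl⟩ := hg
  have hn : (2 * n + 1 + 1) / 2 = n + 1 := by omega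
  have hneg : ((n + 1 : ℕ) : ZMod (2 * n + 1)) = -(n : ZMod (2 * n + 1)) := by
    have := ZMod.natCast_self (2 * n + 1)
    push_cast at this ⊢
    linear_combination this
  rw [hn, hneg, neg_neg]
  have hb : ∀ b : ZMod (2 * n + 1), b.valMinAbs.natAbs ≤ n := fun b => by
    have := ZMod.natAbs_valMinAbs_le b
    omega
  have ha := ZMod.coe_valMinAbs a
  constructor
  · rintro ⟨h1, h2⟩
    by_cases hlt : a.valMinAbs.natAbs < n
    · exfalso
      by_cases hs : 0 ≤ a.valMinAbs
      · have : (a + 1).valMinAbs = a.valMinAbs + 1 := by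
          rw [ZMod.valMinAbs_spec]
          refine ⟨by push_cast [ZMod.coe_valMinAbs]; rfl, ?_, ?_⟩ <;> push_cast <;> omega
        omega
      · have : (a - 1).valMinAbs = a.valMinAbs - 1 := by
          rw [ZMod.valMinAbs_spec]
          refine ⟨by push_cast [ZMod.coe_valMinAbs]; rfl, ?_, ?_⟩ <;> push_cast <;> omega
        omega
    · have hbn := hb a
      have : a.valMinAbs = n ∨ a.valMinAbs = -n := by omega
      rcases this with h | h <;> rw [h] at ha <;> rw [← ha] <;> simp
  · intro h
    have : a.valMinAbs.natAbs = n := by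
      rcases h with rfl | rfl
      · rw [ZMod.natAbs_valMinAbs_neg]
        have : ((n : ZMod (2 * n + 1))).valMinAbs = n := by
          rw [ZMod.valMinAbs_spec]
          refine ⟨by push_cast; rfl, ?_, ?_⟩ <;> push_cast <;> omega
        omega
      · have : ((n : ZMod (2 * n + 1))).valMinAbs = n := by
          rw [ZMod.valMinAbs_spec]
          refine ⟨by push_cast; rfl, ?_, ?_⟩ <;> push_cast <;> omega
        omega
    rw [this]
    exact ⟨hb _, hb _⟩

end Antipodal

-- Mutually maximally distant vertices of an odd unicyclic graph

section Structure

variable {G : SimpleGraph V} {g : ℕ} {v : ZMod g → V}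

theorem IsCycleLabelling.adj_pred (hv : IsCycleLabelling G g v) (i : ZMod g) :
    G.Adj (v i) (v (i - 1)) := by
  have := hv.2.2 (i - 1)
  rw [sub_add_cancel] at this
  exact this.symm

theorem IsCycleLabelling.succ_ne_pred (hv : IsCycleLabelling G g v) (i : ZMod g) :
    v (i + 1) ≠ v (i - 1) := by
  intro h
  have h := hv.2.1 h
  have h3 : ((2 : ℕ) : ZMod g) = 0 := by
    push_cast
    linear_combination h
  exact natCast_ne_zero_of_lt (by omega) (by have := hv.1; omega) h3

theorem notMem_cycleEdges_of_ne (hv : IsCycleLabelling G g v) {i : ZMod g} {y : V}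
    (h1 : y ≠ v (i + 1)) (h2 : y ≠ v (i - 1)) : s(v i, y) ∉ cycleEdges v := by
  rintro ⟨j, hj⟩
  simp only [Sym2.eq_iff] at hj
  rcases hj with ⟨h3, h4⟩ | ⟨h3, h4⟩
  · obtain rfl := hv.2.1 h3
    exact h1 h4.symm
  · obtain rfl := hv.2.1 h4
    rw [add_sub_cancel_right] at h2
    exact h2 h3.symm

theorem notMem_cycleEdges_of_notMem_range {x y : V} (hx : x ∉ Set.range v) :
    s(x, y) ∉ cycleEdges v := by
  rintro ⟨j, hj⟩
  simp only [Sym2.eq_iff] at hj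
  rcases hj with ⟨h, -⟩ | ⟨-, h⟩
  · exact hx ⟨_, h⟩
  · exact hx ⟨_, h⟩

theorem root_cycle (hG : IsUnicyclic G) (hv : IsCycleLabelling G g v) (i : ZMod g) :
    root hG.1 v (v i) = i :=
  root_eq hG hv (.refl _)

variable [Fintype V] [DecidableRel G.Adj]

theorem two_le_degree (hv : IsCycleLabelling G g v) (i : ZMod g) : 2 ≤ G.degree (v i) := by
  classical
  rw [← G.card_neighborFinset_eq_degree, ← Finset.card_pair (hv.succ_ne_pred i)]
  refine Finset.card_le_card ?_
  intro y hy
  rw [SimpleGraph.mem_neighborFinset]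
  rw [Finset.mem_insert, Finset.mem_singleton] at hy
  rcases hy with rfl | rfl
  · exact hv.2.2 i
  · exact hv.adj_pred i

theorem adj_cycle_iff (hv : IsCycleLabelling G g v) {i : ZMod g} (hd : G.degree (v i) = 2)
    (y : V) : G.Adj (v i) y ↔ y = v (i + 1) ∨ y = v (i - 1) := by
  classical
  have h : ({v (i + 1), v (i - 1)} : Finset V) = G.neighborFinset (v i) := by
    refine Finset.eq_of_subset_of_card_le ?_ ?_
    · intro y hy
      rw [SimpleGraph.mem_neighborFinset]
      rw [Finset.mem_insert, Finset.mem_singleton] at hy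
      rcases hy with rfl | rfl
      · exact hv.2.2 i
      · exact hv.adj_pred i
    · rw [Finset.card_pair (hv.succ_ne_pred i), G.card_neighborFinset_eq_degree, hd]
  rw [← SimpleGraph.mem_neighborFinset, ← h, Finset.mem_insert, Finset.mem_singleton]

theorem exists_adj_notMem_cycleEdges (hv : IsCycleLabelling G g v) {i : ZMod g}
    (hd : 3 ≤ G.degree (v i)) :
    ∃ y, G.Adj (v i) y ∧ y ≠ v (i + 1) ∧ s(v i, y) ∉ cycleEdges v := by
  classical
  have h : ∃ y ∈ G.neighborFinset (v i), y ∉ ({v (i + 1), v (i - 1)} : Finset V) := by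
    refine Finset.exists_mem_notMem_of_card_lt_card ?_
    rw [Finset.card_pair (hv.succ_ne_pred i), G.card_neighborFinset_eq_degree]
    omega
  obtain ⟨y, hy, hne⟩ := h
  rw [SimpleGraph.mem_neighborFinset] at hy
  rw [Finset.mem_insert, Finset.mem_singleton, not_or] at hne
  exact ⟨y, hy, hne.1, notMem_cycleEdges_of_ne hv hne.1 hne.2⟩

/-- The two neighbours lie on the cycle, so in `dist_eq` the tree term of `x` cancels and only the
position of its root matters. -/
theorem maximallyDistant_cycle_iff (hG : IsUnicyclic G) (hg : Odd g)
    (hv : IsCycleLabelling G g v) {b : ZMod g} (hd : G.degree (v b) = 2) (x : V) :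
    MaximallyDistant G (v b) x ↔ root hG.1 v x - b = (((g + 1) / 2 : ℕ) : ZMod g) ∨
      root hG.1 v x - b = -(((g + 1) / 2 : ℕ) : ZMod g) := by
  rw [← natAbs_valMinAbs_isMax_iff hg]
  unfold MaximallyDistant
  simp only [adj_cycle_iff hv hd, forall_eq_or_imp, forall_eq]
  rw [G.dist_comm, G.dist_comm (u := x), G.dist_comm (u := x), dist_eq hG hv, dist_eq hG hv,
    dist_eq hG hv, Nat.add_le_add_iff_right, Nat.add_le_add_iff_right, and_comm,
    show root hG.1 v x - (b + 1) = root hG.1 v x - b - 1 by ring,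
    show root hG.1 v x - (b - 1) = root hG.1 v x - b + 1 by ring]

theorem eq_of_adj_of_degree_eq_one {x : V} (hd : G.degree x = 1) (a b : V) (ha : G.Adj x a)
    (hb : G.Adj x b) : a = b := by
  rw [← G.card_neighborFinset_eq_degree, Finset.card_eq_one] at hd
  obtain ⟨c, hc⟩ := hd
  rw [← SimpleGraph.mem_neighborFinset, hc, Finset.mem_singleton] at ha hb
  rw [ha, hb]

/-- Only leaves and cycle vertices of degree two are maximally distant from some vertex. -/
theorem degree_of_maximallyDistant (hG : IsUnicyclic G) (hv : IsCycleLabelling G g v) {x y : V}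
    (h : MaximallyDistant G x y) (hne : x ≠ y) :
    G.degree x = 1 ∨ ∃ i, v i = x ∧ G.degree x = 2 := by
  classical
  by_cases h1 : G.degree x = 1
  · exact Or.inl h1
  right
  have h0 : 0 < G.degree x := by
    rw [SimpleGraph.degree_pos_iff_exists_adj]
    obtain ⟨p⟩ := hG.1 x y
    cases p with
    | nil => exact absurd rfl hne
    | cons hadj _ => exact ⟨_, hadj⟩
  by_cases hx : x ∈ Set.range v
  · obtain ⟨i, rfl⟩ := hx
    refine ⟨i, rfl, ?_⟩
    by_contra h2
    -- A cycle vertex of degree at least 3 has a bridge besides its cycle edges; off the cycle,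
    -- every edge is a bridge.
    obtain ⟨z, hz, hz1, hz2⟩ := exists_adj_notMem_cycleEdges (i := i) hv (by omega)
    exact not_maximallyDistant_of_isBridge hG.1 (isBridge_of_notMem_cycleEdges hG hv hz hz2)
      hz (hv.2.2 i) hz1.symm y h
  · exfalso
    have h2 : 1 < (G.neighborFinset x).card := by
      rw [G.card_neighborFinset_eq_degree]
      omega
    obtain ⟨a, ha, b, hb, hab⟩ := Finset.one_lt_card.1 h2
    rw [SimpleGraph.mem_neighborFinset] at ha hb
    exact not_maximallyDistant_of_isBridge hG.1 (isBridge_of_notMem_cycleEdges hG hv ha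
      (notMem_cycleEdges_of_notMem_range hx)) ha hb hab.symm y h

theorem leaf_notMem_range (hv : IsCycleLabelling G g v) {x : V} (hx : G.degree x = 1)
    (i : ZMod g) : v i ≠ x := by
  rintro rfl
  have := two_le_degree hv i
  omega

theorem three_le_degree_root (hG : IsUnicyclic G) (hv : IsCycleLabelling G g v) {x : V}
    (hx : G.degree x = 1) : 3 ≤ G.degree (v (root hG.1 v x)) := by
  classical
  have hp := root_reachable hG.1 v x
  have hne := leaf_notMem_range hv hx (root hG.1 v x)
  generalize root hG.1 v x = i at hp hne ⊢
  obtain ⟨p⟩ := hp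
  cases p with
  | nil => exact absurd rfl hne
  | cons hadj _ =>
    rw [SimpleGraph.deleteEdges_adj] at hadj
    by_contra hlt
    have h2 : G.degree (v i) = 2 := by
      have := two_le_degree hv i
      omega
    refine hadj.2 ?_
    rcases (adj_cycle_iff hv h2 _).1 hadj.1 with rfl | rfl
    · exact ⟨i, rfl⟩
    · refine ⟨i - 1, ?_⟩
      simp only [sub_add_cancel]
      exact Sym2.eq_swap

/-- A vertex of the tree at `v i` farthest from `v i` is maximally distant from it and is off the
cycle, hence is a leaf. -/
theorem exists_leaf_of_three_le_degree (hG : IsUnicyclic G) (hv : IsCycleLabelling G g v)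
    {i : ZMod g} (hd : 3 ≤ G.degree (v i)) : (leavesAt G v (v i)).Nonempty := by
  classical
  set H := G.deleteEdges (cycleEdges v) with hH
  have hfin : Set.Finite {x | H.Reachable (v i) x} := Set.toFinite _
  obtain ⟨x, hx, hmax⟩ := hfin.exists_maximalFor (fun x => G.dist (v i) x) _ ⟨v i, .refl _⟩
  rw [Set.mem_ofPred_eq] at hx
  obtain ⟨y, hy, -, hy2⟩ := exists_adj_notMem_cycleEdges hv hd
  have hyH : H.Adj (v i) y := by
    rw [hH, SimpleGraph.deleteEdges_adj]
    exact ⟨hy, hy2⟩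
  have hxi : x ≠ v i := by
    rintro rfl
    have h1 := @hmax y hyH.reachable (by simp)
    simp only [SimpleGraph.dist_self, SimpleGraph.dist_eq_one_iff_adj.2 hy] at h1
    omega
  have hxr : x ∉ Set.range v := by
    rintro ⟨j, rfl⟩
    exact hxi (by rw [eq_of_reachable hG hv hx])
  refine ⟨x, ?_, hx⟩
  have hmd : MaximallyDistant G x (v i) := by
    intro z hz
    by_contra hlt
    have hzH : H.Adj x z := by
      rw [hH, SimpleGraph.deleteEdges_adj]
      exact ⟨hz, notMem_cycleEdges_of_notMem_range hxr⟩
    have h1 := @hmax z (hx.trans hzH.reachable) (by dsimp only; omega)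
    dsimp only at h1
    omega
  rcases degree_of_maximallyDistant hG hv hmd hxi with h | ⟨j, h, -⟩
  · exact h
  · exact absurd ⟨j, h⟩ hxr

/-- The cycle vertices, ordered so that consecutive ones are antipodal. -/
def antipodalOrder (v : ZMod g → V) (k : ZMod g) : V := v (k * (((g + 1) / 2 : ℕ) : ZMod g))

/-- The positions of the cycle vertices of degree at least three. -/
def branchPositions (G : SimpleGraph V) [DecidableRel G.Adj] (v : ZMod g → V) : Set (ZMod g) :=
  {k | 3 ≤ G.degree (antipodalOrder v k)}

/-- The leaves of a graph. -/
def leafSet (G : SimpleGraph V) [DecidableRel G.Adj] : Set V := {x | G.degree x = 1}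

/-- The position of the cycle vertex at which the tree containing `x` is attached. -/
noncomputable def leafPosition (hG : G.Connected) (v : ZMod g → V) (x : V) : ZMod g :=
  2 * root hG v x

/-- A leaf is maximally distant from every other vertex, so adjacency to it is decided by the other
end alone. For cycle vertices of degree 2 the distance criterion becomes a condition on positions.
-/
theorem cyclicModel (hG : IsUnicyclic G) (hg : Odd g) (hv : IsCycleLabelling G g v) :
    CyclicModel (strongResolvingGraph G) (antipodalOrder v) (branchPositions G v) (leafSet G)
      (leafPosition hG.1 v) := by
  change CyclicModel (strongResolvingGraph G) (fun k => v (k * (((g + 1) / 2 : ℕ) : ZMod g)))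
    {k | 3 ≤ G.degree (v (k * (((g + 1) / 2 : ℕ) : ZMod g)))} {x | G.degree x = 1}
    (fun x => 2 * root hG.1 v x)
  have h2 := two_mul_half hg
  set d := (((g + 1) / 2 : ℕ) : ZMod g)
  have hinj : Function.Injective fun k => v (k * d) := by
    intro a b hab
    have := hv.2.1 hab
    linear_combination 2 * this - (a - b) * h2
  have hdeg : ∀ {p}, p ∉ {k | 3 ≤ G.degree (v (k * d))} → G.degree (v (p * d)) = 2 := by
    intro p hp
    rw [Set.mem_ofPred_eq] at hp
    have := two_le_degree hv (p * d)
    omega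
  have hroot : ∀ a : ZMod g, 2 * (a * d) = a := fun a => by linear_combination a * h2
  -- Doubling turns an index difference of ±(g+1)/2 into a position difference of ±1.
  have hiff : ∀ a b : ZMod g, a - b * d = d ∨ a - b * d = -d ↔ b = 2 * a + 1 ∨ b = 2 * a - 1 := by
    intro a b
    constructor
    · rintro (h | h)
      · right; linear_combination (-2) * h - (b + 1) * h2
      · left; linear_combination (-2) * h - (b - 1) * h2
    · rintro (h | h)
      · right; linear_combination -d * h - a * h2
      · left; linear_combination -d * h - a * h2
  refine ⟨hinj, ?_, ?_, ?_, ?_, ?_, ?_, ?_⟩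
  · intro x y hx hy hne
    exact ⟨hne, maximallyDistant_of_subsingleton hG.1 hne (eq_of_adj_of_degree_eq_one hx),
      maximallyDistant_of_subsingleton hG.1 hne.symm (eq_of_adj_of_degree_eq_one hy)⟩
  · intro x p hx hp
    have hne : x ≠ v (p * d) := (leaf_notMem_range hv hx _).symm
    have h1 := maximallyDistant_of_subsingleton hG.1 hne (eq_of_adj_of_degree_eq_one hx)
    rw [← hiff, ← maximallyDistant_cycle_iff hG hg hv (hdeg hp)]
    exact ⟨fun h => h.2.2, fun h => ⟨hne, h1, h⟩⟩
  · intro p q hp hq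
    have e1 := maximallyDistant_cycle_iff hG hg hv (hdeg hp) (v (q * d))
    have e2 := maximallyDistant_cycle_iff hG hg hv (hdeg hq) (v (p * d))
    rw [root_cycle hG hv, hiff, hroot] at e1 e2
    constructor
    · intro h
      rcases e1.1 h.2.1 with h | h
      · exact Or.inr h
      · left; rw [h]; ring
    · intro h
      refine ⟨?_, e1.2 ?_, e2.2 ?_⟩
      · intro heq
        have heq := hinj heq
        have h3 : ((1 : ℕ) : ZMod g) = 0 := by
          push_cast
          rcases h with h | h <;> rw [heq] at h <;> linear_combination -h
        exact natCast_ne_zero_of_lt (by omega) (by have := hv.1; omega) h3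
      · rcases h with rfl | rfl
        · right; ring
        · left; ring
      · rcases h with rfl | rfl
        · left; ring
        · right; ring
  · intro x y hxy
    rcases degree_of_maximallyDistant hG hv hxy.2.1 hxy.1 with h1 | ⟨i, rfl, h1⟩
    · exact Or.inl h1
    · right
      have : 2 * i * d = i := by linear_combination i * h2
      exact ⟨2 * i, by simp only [Set.mem_ofPred_eq]; rw [this, h1]; omega, by simp only [this]⟩
  · intro x hx
    rw [Set.mem_ofPred_eq, show 2 * root hG.1 v x * d = root hG.1 v x by
      linear_combination root hG.1 v x * h2]
    exact three_le_degree_root hG hv hx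
  · intro b hb
    obtain ⟨x, hx, hr⟩ := exists_leaf_of_three_le_degree hG hv hb
    refine ⟨x, hx, ?_⟩
    rw [root_eq hG hv hr, hroot]
  · intro x p hx
    exact leaf_notMem_range hv hx _

end Structure

end OddUnicyclic

namespace OddUnicyclic

-- Runs of a circular order and their independent subsets

section Gaps

variable {g : ℕ} {B : Set (ZMod g)}

/-- Number of forward steps from `p` to the set `B`. -/
noncomputable def fwd (B : Set (ZMod g)) (p : ZMod g) : ℕ := sInf {n : ℕ | p + n ∈ B}

/-- Number of backward steps from `p` to the set `B`. -/
noncomputable def back (B : Set (ZMod g)) (p : ZMod g) : ℕ := sInf {n : ℕ | p - n ∈ B}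

theorem fwd_le {p : ZMod g} {n : ℕ} (h : p + n ∈ B) : fwd B p ≤ n := Nat.sInf_le h

theorem back_le {p : ZMod g} {n : ℕ} (h : p - n ∈ B) : back B p ≤ n := Nat.sInf_le h

theorem fwd_eq_zero {p : ZMod g} (h : p ∈ B) : fwd B p = 0 :=
  Nat.le_zero.1 (fwd_le (by simpa using h))

theorem back_eq_zero {p : ZMod g} (h : p ∈ B) : back B p = 0 :=
  Nat.le_zero.1 (back_le (by simpa using h))

/-- Both step counts are 0 on `B`, so an odd count already places the position inside a run. -/
theorem notMem_of_odd_fwd {p : ZMod g} (h : Odd (fwd B p)) : p ∉ B := fun hp => by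
  simp [fwd_eq_zero hp] at h

theorem notMem_of_odd_back {p : ZMod g} (h : Odd (back B p)) : p ∉ B := fun hp => by
  simp [back_eq_zero hp] at h

/-- The canonical position `a` is missed by `T`. -/
def Missed (B : Set (ZMod g)) (T : Finset (ZMod g)) (a : ZMod g) : Prop :=
  Odd (back B a) ∧ a ∉ T ∧ a + 1 ∉ T

theorem missed_pred {T : Finset (ZMod g)} (hT : ∀ p ∈ T, p ∉ B) {b : ZMod g} (hb : b ∈ B)
    (h : b - 1 ∉ T) (ho : Odd (back B (b - 1))) : Missed B T (b - 1) :=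
  ⟨ho, h, fun h' => hT _ h' (by rwa [sub_add_cancel])⟩

variable [NeZero g]

theorem fwd_mem (hB : B.Nonempty) (p : ZMod g) : p + fwd B p ∈ B := by
  obtain ⟨b, hb⟩ := hB
  exact Nat.sInf_mem (s := {n : ℕ | p + n ∈ B}) ⟨(b - p).val, by simpa using hb⟩

theorem back_mem (hB : B.Nonempty) (p : ZMod g) : p - back B p ∈ B := by
  obtain ⟨b, hb⟩ := hB
  exact Nat.sInf_mem (s := {n : ℕ | p - n ∈ B}) ⟨(p - b).val, by simpa using hb⟩

theorem fwd_le_val {b : ZMod g} (hb : b ∈ B) (p : ZMod g) : fwd B p ≤ (b - p).val :=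
  fwd_le (by simpa using hb)

theorem back_le_val {b : ZMod g} (hb : b ∈ B) (p : ZMod g) : back B p ≤ (p - b).val :=
  back_le (by simpa using hb)

theorem fwd_lt (hB : B.Nonempty) (p : ZMod g) : fwd B p < g :=
  (fwd_le_val hB.some_mem p).trans_lt (ZMod.val_lt _)

theorem back_lt (hB : B.Nonempty) (p : ZMod g) : back B p < g :=
  (back_le_val hB.some_mem p).trans_lt (ZMod.val_lt _)

theorem fwd_eq_add_one (hB : B.Nonempty) {p : ZMod g} (hp : p ∉ B) :
    fwd B p = fwd B (p + 1) + 1 := by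
  have h0 : fwd B p ≠ 0 := fun h => hp (by simpa [h] using fwd_mem hB p)
  obtain ⟨n, hn⟩ := Nat.exists_eq_succ_of_ne_zero h0
  apply le_antisymm
  · refine fwd_le ?_
    have := fwd_mem hB (p + 1)
    push_cast
    rwa [add_comm (fwd B (p + 1) : ZMod g), ← add_assoc]
  · rw [hn, Nat.succ_eq_add_one, Nat.add_le_add_iff_right]
    refine fwd_le ?_
    have := fwd_mem hB p
    rw [hn] at this
    push_cast at this
    rwa [add_assoc, add_comm (1 : ZMod g)]

theorem back_eq_add_one (hB : B.Nonempty) {p : ZMod g} (hp : p ∉ B) :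
    back B p = back B (p - 1) + 1 := by
  have h0 : back B p ≠ 0 := fun h => hp (by simpa [h] using back_mem hB p)
  obtain ⟨n, hn⟩ := Nat.exists_eq_succ_of_ne_zero h0
  apply le_antisymm
  · refine back_le ?_
    have := back_mem hB (p - 1)
    push_cast
    rwa [add_comm (back B (p - 1) : ZMod g), ← sub_sub]
  · rw [hn, Nat.succ_eq_add_one, Nat.add_le_add_iff_right]
    refine back_le ?_
    have := back_mem hB p
    rw [hn] at this
    push_cast at this
    rwa [sub_sub, add_comm (1 : ZMod g)]

theorem back_add_one (hB : B.Nonempty) {p : ZMod g} (hp : p + 1 ∉ B) :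
    back B (p + 1) = back B p + 1 := by
  rw [back_eq_add_one hB hp, add_sub_cancel_right]

theorem fwd_sub_one (hB : B.Nonempty) {p : ZMod g} (hp : p - 1 ∉ B) :
    fwd B (p - 1) = fwd B p + 1 := by
  rw [fwd_eq_add_one hB hp, sub_add_cancel]

theorem add_fwd_add_one (hB : B.Nonempty) {p : ZMod g} (hp : p ∉ B) :
    p + 1 + fwd B (p + 1) = p + fwd B p := by
  rw [fwd_eq_add_one hB hp]
  push_cast
  ring

theorem add_one_sub_back (hB : B.Nonempty) {p : ZMod g} (hp : p + 1 ∉ B) :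
    p + 1 - back B (p + 1) = p - back B p := by
  rw [back_add_one hB hp]
  push_cast
  ring

theorem add_one_notMem {p : ZMod g} (hB : B.Nonempty) (hp : p ∉ B) (h : Even (fwd B p)) :
    p + 1 ∉ B := by
  refine notMem_of_odd_fwd (?_ : Odd (fwd B (p + 1)))
  rw [fwd_eq_add_one hB hp] at h
  exact Nat.not_even_iff_odd.1 (fun h' => (Nat.even_add_one.1 h) h')

/-- A run returning to `u` would go all the way round, and `b` would have stopped it. -/
theorem succ_fwd_ne {u b : ZMod g} (hb : b ∈ B) (hne : b ≠ u) :
    u + 1 + fwd B (u + 1) ≠ u := by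
  intro h
  have h1 := fwd_le_val hb (u + 1)
  have h2 := ZMod.val_lt (b - (u + 1))
  have h3 : ((fwd B (u + 1) + 1 : ℕ) : ZMod g) = 0 := by
    push_cast
    linear_combination h
  have h4 := Nat.le_of_dvd (by omega) ((ZMod.natCast_eq_zero_iff _ _).1 h3)
  have h5 : (b - (u + 1)).val = fwd B (u + 1) := by omega
  have h6 := ZMod.natCast_zmod_val (b - (u + 1))
  rw [h5] at h6
  exact hne (by linear_combination h - h6)

theorem pred_back_ne {u b : ZMod g} (hb : b ∈ B) (hne : b ≠ u) :
    u - 1 - back B (u - 1) ≠ u := by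
  intro h
  have h1 := back_le_val hb (u - 1)
  have h2 := ZMod.val_lt (u - 1 - b)
  have h3 : ((back B (u - 1) + 1 : ℕ) : ZMod g) = 0 := by
    push_cast
    linear_combination -h
  have h4 := Nat.le_of_dvd (by omega) ((ZMod.natCast_eq_zero_iff _ _).1 h3)
  have h5 : (u - 1 - b).val = back B (u - 1) := by omega
  have h6 := ZMod.natCast_zmod_val (u - 1 - b)
  rw [h5] at h6
  exact hne (by linear_combination h + h6)

/-- A run bounded by the same position on both sides has g - 1 vertices, an even number. -/
theorem not_odd_back_of_eq (hg : Odd g) (hB : B.Nonempty) {u : ZMod g}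
    (h : u - 1 - back B (u - 1) = u) : ¬ Odd (back B (u - 1)) := by
  have h2 := back_lt hB (u - 1)
  have h3 : ((back B (u - 1) + 1 : ℕ) : ZMod g) = 0 := by
    push_cast
    linear_combination -h
  have h4 := Nat.le_of_dvd (by omega) ((ZMod.natCast_eq_zero_iff _ _).1 h3)
  have h5 : back B (u - 1) + 1 = g := by omega
  rw [← h5] at hg
  intro h6
  exact Nat.not_even_iff_odd.2 hg h6.add_one

open Classical in
/-- The canonical positions: every other one of each run outside `B`, beginning with the first. -/
noncomputable def canonical (B : Set (ZMod g)) : Finset (ZMod g) :=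
  Finset.univ.filter fun p => Odd (back B p)

theorem mem_canonical {p : ZMod g} : p ∈ canonical B ↔ Odd (back B p) := by
  simp [canonical]

theorem odd_back_sub_one (hB : B.Nonempty) {p : ZMod g} (hp : p ∉ B) (h : ¬ Odd (back B p)) :
    Odd (back B (p - 1)) := by
  rw [back_eq_add_one hB hp, Nat.odd_add_one, not_not] at h
  exact h

/-- Pair each canonical position with its successor. Every element of `T` lies in such a pair, no
pair contains two of them, and a missed pair contains none. -/
theorem card_add_card_le (hB : B.Nonempty) {T M : Finset (ZMod g)} (hT : ∀ p ∈ T, p ∉ B)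
    (hind : ∀ p ∈ T, p + 1 ∉ T) (hM : ∀ a ∈ M, Missed B T a) :
    T.card + M.card ≤ (canonical B).card := by
  classical
  have hsub : M ⊆ canonical B := fun a ha => mem_canonical.2 (hM a ha).1
  rw [← Nat.le_sub_iff_add_le (Finset.card_le_card hsub), ← Finset.card_sdiff_of_subset hsub]
  refine Finset.card_le_card_of_injOn (fun p => if Odd (back B p) then p else p - 1) ?_ ?_
  · intro p hp
    rw [Finset.mem_coe] at hp
    rw [Finset.mem_coe, Finset.mem_sdiff, mem_canonical]
    dsimp only
    split_ifs with h
    · exact ⟨h, fun hm => (hM p hm).2.1 hp⟩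
    · refine ⟨odd_back_sub_one hB (hT p hp) h, fun hm => (hM _ hm).2.2 ?_⟩
      rwa [sub_add_cancel]
  · intro p hp q hq hpq
    rw [Finset.mem_coe] at hp hq
    dsimp only at hpq
    split_ifs at hpq with h1 h2 h2
    · exact hpq
    · exact absurd (by rwa [hpq, sub_add_cancel]) (hind p hp)
    · exact absurd (by rwa [← hpq, sub_add_cancel]) (hind q hq)
    · exact sub_left_injective hpq

/-- Every pair outside the conceded set `E` contributes an element of `T`. A second member has even
count, so it is not canonical and cannot also be the first member of another pair. -/
theorem card_canonical_le {T E : Finset (ZMod g)}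
    (h : ∀ a, Odd (back B a) → a ∉ E → a ∈ T ∨ (a + 1 ∈ T ∧ Even (back B (a + 1)))) :
    (canonical B).card ≤ T.card + E.card := by
  classical
  have h1 : (canonical B \ E).card ≤ T.card := by
    refine Finset.card_le_card_of_injOn (fun a => if a ∈ T then a else a + 1) ?_ ?_
    · intro a ha
      rw [Finset.mem_coe, Finset.mem_sdiff, mem_canonical] at ha
      rw [Finset.mem_coe]
      dsimp only
      split_ifs with haT
      · exact haT
      · exact ((h a ha.1 ha.2).resolve_left haT).1
    · intro a ha b hb hab
      rw [Finset.mem_coe, Finset.mem_sdiff, mem_canonical] at ha hb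
      dsimp only at hab
      split_ifs at hab with haT hbT hbT
      · exact hab
      · have := ((h b hb.1 hb.2).resolve_left hbT).2
        rw [← hab] at this
        exact absurd ha.1 (Nat.not_odd_iff_even.2 this)
      · have := ((h a ha.1 ha.2).resolve_left haT).2
        rw [hab] at this
        exact absurd hb.1 (Nat.not_odd_iff_even.2 this)
      · exact add_left_injective 1 hab
  have h2 := Finset.le_card_sdiff E (canonical B)
  omega

/-- Here `p` is an even-numbered vertex of an odd run. The pair starting at `p + 1` is either missed
or represented by `p + 2`, again even-numbered. The last vertex of the run is odd-numbered, so this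
ends at a missed pair of the same run. -/
theorem exists_missed (hB : B.Nonempty) {T : Finset (ZMod g)} (hT : ∀ p ∈ T, p ∉ B)
    (hind : ∀ p ∈ T, p + 1 ∉ T) {p : ZMod g} (hp : p ∈ T) (hb : Even (back B p))
    (hf : Even (fwd B p)) :
    ∃ a, Missed B T a ∧ a - back B a = p - back B p ∧ a + fwd B a = p + fwd B p := by
  induction hn : fwd B p using Nat.strong_induction_on generalizing p with
  | _ n ih =>
    subst hn
    have h1 := add_one_notMem hB (hT p hp) hf
    have hs1 := add_one_sub_back hB h1
    have he1 := add_fwd_add_one hB (hT p hp)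
    have hb1 := back_add_one hB h1
    by_cases h2 : p + 1 + 1 ∈ T
    · have hs2 := add_one_sub_back hB (hT _ h2)
      have he2 := add_fwd_add_one hB h1
      have hf1 := fwd_eq_add_one hB (hT p hp)
      have hf2 := fwd_eq_add_one hB h1
      have hb2 := back_add_one hB (hT _ h2)
      obtain ⟨a, ha, ha1, ha2⟩ := ih (fwd B (p + 1 + 1)) (by omega) h2
        (by rw [hb2, hb1]; exact hb.add_one.add_one) (by
          rw [hf1, hf2] at hf
          rwa [Nat.even_add_one, Nat.even_add_one, not_not] at hf) rfl
      exact ⟨a, ha, ha1.trans (hs2.trans hs1), ha2.trans (he2.trans he1)⟩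
    · refine ⟨p + 1, ⟨?_, hind p hp, h2⟩, hs1, he1⟩
      rw [hb1]
      exact hb.add_one

/-- If `T` avoids the first vertex of an odd run, it misses the first pair or uses the second
vertex, where `exists_missed` applies. -/
theorem exists_missed_succ (hB : B.Nonempty) {T : Finset (ZMod g)} (hT : ∀ p ∈ T, p ∉ B)
    (hind : ∀ p ∈ T, p + 1 ∉ T) {b : ZMod g} (hb : b ∈ B) (h : b + 1 ∉ T)
    (ho : Odd (fwd B (b + 1))) : ∃ a, Missed B T a ∧ a - back B a = b := by
  have h1 := notMem_of_odd_fwd ho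
  have hb1 : back B (b + 1) = 1 := by rw [back_add_one hB h1, back_eq_zero hb]
  have hs1 : b + 1 - back B (b + 1) = b := by rw [hb1]; simp
  by_cases h2 : b + 1 + 1 ∈ T
  · have hb2 := back_add_one hB (hT _ h2)
    obtain ⟨a, ha, ha1, -⟩ := exists_missed hB hT hind h2 (by rw [hb2, hb1]; decide) (by
      rw [fwd_eq_add_one hB h1, Nat.odd_add_one, Nat.not_odd_iff_even] at ho
      exact ho)
    exact ⟨a, ha, ha1.trans ((add_one_sub_back hB (hT _ h2)).trans hs1)⟩
  · exact ⟨b + 1, ⟨by rw [hb1]; decide, h, h2⟩, hs1⟩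

open Classical in
/-- Every other position of each run, counted from the end in the runs selected by `Z` and from
the beginning in the others. -/
noncomputable def alternating (B : Set (ZMod g)) (Z : ZMod g → Prop) : Finset (ZMod g) :=
  Finset.univ.filter fun p => p ∉ B ∧ if Z p then Odd (fwd B p) else Odd (back B p)

theorem mem_alternating {Z : ZMod g → Prop} {p : ZMod g} :
    p ∈ alternating B Z ↔ p ∉ B ∧ ((Z p ∧ Odd (fwd B p)) ∨ (¬ Z p ∧ Odd (back B p))) := by
  classical
  by_cases h : Z p <;> simp [alternating, h]

theorem alternating_succ (hB : B.Nonempty) {Z : ZMod g → Prop}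
    (hZ : ∀ p, p ∉ B → p + 1 ∉ B → (Z p ↔ Z (p + 1))) {p : ZMod g} (hp : p ∈ alternating B Z) :
    p + 1 ∉ alternating B Z := by
  intro hq
  rw [mem_alternating] at hp hq
  have hz := hZ p hp.1 hq.1
  rcases hp.2 with ⟨h1, h2⟩ | ⟨h1, h2⟩
  · rcases hq.2 with ⟨-, h4⟩ | ⟨h3, -⟩
    · rw [fwd_eq_add_one hB hp.1, Nat.odd_add_one] at h2
      exact h2 h4
    · exact h3 (hz.1 h1)
  · rcases hq.2 with ⟨h3, -⟩ | ⟨-, h4⟩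
    · exact h1 (hz.2 h3)
    · rw [back_add_one hB hq.1, Nat.odd_add_one] at h4
      exact h4 h2

/-- In an odd run both ways of counting select the first members of the pairs; in an even run
counting from the end selects the second members. The hypothesis `hZ` makes the choice constant on
runs. -/
theorem alternating_covers (hB : B.Nonempty) {Z : ZMod g → Prop}
    (hZ : ∀ p, p ∉ B → p + 1 ∉ B → (Z p ↔ Z (p + 1))) {a : ZMod g} (ha : Odd (back B a)) :
    a ∈ alternating B Z ∨ (a + 1 ∈ alternating B Z ∧ Even (back B (a + 1))) := by
  have haB := notMem_of_odd_back ha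
  rw [mem_alternating, mem_alternating]
  by_cases hz : Z a
  · by_cases hf : Odd (fwd B a)
    · exact Or.inl ⟨haB, Or.inl ⟨hz, hf⟩⟩
    · right
      have h1 := add_one_notMem hB haB (Nat.not_odd_iff_even.1 hf)
      refine ⟨⟨h1, Or.inl ⟨(hZ a haB h1).1 hz, ?_⟩⟩, ?_⟩
      · rwa [fwd_eq_add_one hB haB, Nat.odd_add_one, not_not] at hf
      · rw [back_add_one hB h1]
        exact ha.add_one
  · exact Or.inl ⟨haB, Or.inr ⟨hz, ha⟩⟩

theorem card_canonical_le_alternating (hB : B.Nonempty) {Z : ZMod g → Prop}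
    (hZ : ∀ p, p ∉ B → p + 1 ∉ B → (Z p ↔ Z (p + 1))) :
    (canonical B).card ≤ (alternating B Z).card := by
  simpa using card_canonical_le (E := ∅) fun a ha _ => alternating_covers hB hZ ha

end Gaps

end OddUnicyclic

namespace OddUnicyclic

/-- The positions of the cycle vertices of degree at least three not adjacent to an odd run. -/
def evenPositions {g : ℕ} (B : Set (ZMod g)) : Set (ZMod g) :=
  {u | u ∈ B ∧ ¬ Odd (fwd B (u + 1)) ∧ ¬ Odd (back B (u - 1))}

namespace CyclicModel

variable {V : Type*} {S : SimpleGraph V} {g : ℕ} {w : ZMod g → V} {B : Set (ZMod g)}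
  {L : Set V} {P : V → ZMod g}

-- Independent sets of the cyclic model

section Counting

variable [Fintype V]

open Classical in
/-- The vertices that are isolated in the strong resolving graph. -/
noncomputable def rest (w : ZMod g → V) (B : Set (ZMod g)) (L : Set V) : Finset V :=
  Finset.univ.filter fun x => x ∉ L ∧ ∀ p, p ∉ B → w p ≠ x

open Classical in
/-- The leaves in `I`. -/
noncomputable def leafPart (L : Set V) (I : Finset V) : Finset V := I.filter fun x => x ∈ L

omit [Fintype V] in
theorem mem_leafPart {I : Finset V} {x : V} : x ∈ leafPart L I ↔ x ∈ I ∧ x ∈ L := by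
  simp [leafPart]

theorem mem_rest {x : V} : x ∈ rest w B L ↔ x ∉ L ∧ ∀ p, p ∉ B → w p ≠ x := by
  simp [rest]

variable [NeZero g]

open Classical in
/-- The positions outside `B` of the vertices in `I`. -/
noncomputable def positions (w : ZMod g → V) (B : Set (ZMod g)) (I : Finset V) :
    Finset (ZMod g) :=
  Finset.univ.filter fun p => p ∉ B ∧ w p ∈ I

omit [Fintype V] in
theorem mem_positions {I : Finset V} {p : ZMod g} : p ∈ positions w B I ↔ p ∉ B ∧ w p ∈ I := by
  simp [positions]

theorem card_le (w : ZMod g → V) (B : Set (ZMod g)) (L : Set V) (I : Finset V) :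
    I.card ≤ (rest w B L).card + (leafPart L I).card + (positions w B I).card := by
  classical
  have h : I ⊆ rest w B L ∪ leafPart L I ∪ (positions w B I).image w := by
    intro x hx
    rw [Finset.mem_union, Finset.mem_union, mem_rest, mem_leafPart, Finset.mem_image]
    by_cases h1 : x ∈ L
    · exact Or.inl (Or.inr ⟨hx, h1⟩)
    · by_cases h2 : ∃ p, p ∉ B ∧ w p = x
      · obtain ⟨p, hp, rfl⟩ := h2
        exact Or.inr ⟨p, mem_positions.2 ⟨hp, hx⟩, rfl⟩
      · push Not at h2
        exact Or.inl (Or.inl ⟨h1, h2⟩)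
  refine (Finset.card_le_card h).trans ((Finset.card_union_le _ _).trans ?_)
  exact Nat.add_le_add (Finset.card_union_le _ _) Finset.card_image_le

variable (M : CyclicModel S w B L P) {I : Finset V} (hI : S.IsIndepSet I)

include M hI

omit [Fintype V] in
theorem positions_succ {p : ZMod g} (hp : p ∈ positions w B I) : p + 1 ∉ positions w B I := by
  intro hq
  rw [mem_positions] at hp hq
  have hadj := (M.adj_iff hp.1 hq.1).2 (Or.inl rfl)
  exact hI hp.2 hq.2 hadj.ne hadj

omit [Fintype V] in
theorem succ_notMem_positions {x : V} (hx : x ∈ leafPart L I) :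
    P x + 1 ∉ positions w B I := by
  intro hq
  rw [mem_leafPart] at hx
  rw [mem_positions] at hq
  have hadj := (M.leaf_adj_iff hx.2 hq.1).2 (Or.inl rfl)
  exact hI hx.1 hq.2 hadj.ne hadj

omit [Fintype V] in
theorem pred_notMem_positions {x : V} (hx : x ∈ leafPart L I) :
    P x - 1 ∉ positions w B I := by
  intro hq
  rw [mem_leafPart] at hx
  rw [mem_positions] at hq
  have hadj := (M.leaf_adj_iff hx.2 hq.1).2 (Or.inr rfl)
  exact hI hx.1 hq.2 hadj.ne hadj

omit [Fintype V] [NeZero g] in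
theorem card_leafPart_le : (leafPart L I).card ≤ 1 := by
  rw [Finset.card_le_one]
  intro x hx y hy
  rw [mem_leafPart] at hx hy
  by_contra hne
  exact hI hx.1 hy.1 hne (M.leaf_adj_leaf hx.2 hy.2 hne)

/-- The vertices of `I` split into isolated ones, leaves and run vertices, and only the last are
diminished by missed pairs. -/
theorem card_add_card_le (hB : B.Nonempty) {E : Finset (ZMod g)}
    (hE : ∀ a ∈ E, Missed B (positions w B I) a) :
    I.card + E.card ≤ (rest w B L).card + (leafPart L I).card + (canonical B).card := by
  have h1 := card_le w B L I
  have h2 := OddUnicyclic.card_add_card_le hB (T := positions w B I)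
    (fun p hp => (mem_positions.1 hp).1) (fun p hp => M.positions_succ hI hp) hE
  omega

omit hI

omit [NeZero g] in
/-- An independent set assembled from the isolated vertices, at most one leaf, and positions
outside `B`. -/
theorem exists_indepSet {T : Finset (ZMod g)} {l : Finset V} (hT : ∀ p ∈ T, p ∉ B)
    (hind : ∀ p ∈ T, p + 1 ∉ T) (hl : ∀ x ∈ l, x ∈ L) (hl1 : l.card ≤ 1)
    (hlT : ∀ x ∈ l, P x + 1 ∉ T ∧ P x - 1 ∉ T) :
    ∃ I : Finset V, S.IsIndepSet I ∧ I.card = (rest w B L).card + l.card + T.card ∧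
      rest w B L ⊆ I ∧ l ⊆ I ∧ ∀ p ∈ T, w p ∈ I := by
  classical
  refine ⟨rest w B L ∪ l ∪ T.image w, ?_, ?_,
    fun x hx => Finset.mem_union_left _ (Finset.mem_union_left _ hx),
    fun x hx => Finset.mem_union_left _ (Finset.mem_union_right _ hx),
    fun p hp => Finset.mem_union_right _ (Finset.mem_image_of_mem _ hp)⟩
  · have key : ∀ x ∈ rest w B L ∪ l ∪ T.image w, ∀ y, S.Adj x y →
        x ∈ l ∨ ∃ p ∈ T, w p = x := by
      intro x hx y hxy
      rw [Finset.mem_union, Finset.mem_union, mem_rest, Finset.mem_image] at hx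
      rcases hx with (⟨h1, h2⟩ | h) | h
      · rcases M.mem_of_adj hxy with h3 | ⟨p, hp, h3⟩
        · exact absurd h3 h1
        · exact absurd h3 (h2 p hp)
      · exact Or.inl h
      · exact Or.inr h
    intro x hx y hy hne hxy
    rcases key x hx y hxy with h1 | ⟨p, hp, rfl⟩ <;>
      rcases key y hy _ hxy.symm with h2 | ⟨q, hq, rfl⟩
    · exact hne (Finset.card_le_one.1 hl1 _ h1 _ h2)
    · rcases (M.leaf_adj_iff (hl _ h1) (hT q hq)).1 hxy with rfl | rfl
      · exact (hlT _ h1).1 hq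
      · exact (hlT _ h1).2 hq
    · rcases (M.leaf_adj_iff (hl _ h2) (hT p hp)).1 hxy.symm with rfl | rfl
      · exact (hlT _ h2).1 hp
      · exact (hlT _ h2).2 hp
    · rcases (M.adj_iff (hT p hp) (hT q hq)).1 hxy with rfl | rfl
      · exact hind p hp hq
      · exact hind q hq hp
  · rw [Finset.card_union_of_disjoint, Finset.card_union_of_disjoint,
      Finset.card_image_of_injective _ M.injective]
    · rw [Finset.disjoint_left]
      intro x hx hxl
      exact (mem_rest.1 hx).1 (hl x hxl)
    · rw [Finset.disjoint_left]
      intro x hx hxT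
      obtain ⟨p, hp, rfl⟩ := Finset.mem_image.1 hxT
      rcases Finset.mem_union.1 hx with h | h
      · exact (mem_rest.1 h).2 p (hT p hp) rfl
      · exact M.leaf_ne (hl _ h) rfl

omit M in
theorem mem_cases (w : ZMod g → V) (B : Set (ZMod g)) (L : Set V) (x : V) :
    x ∈ L ∨ (∃ p, p ∉ B ∧ w p = x) ∨ x ∈ rest w B L := by
  by_cases h1 : x ∈ L
  · exact Or.inl h1
  · by_cases h2 : ∃ p, p ∉ B ∧ w p = x
    · exact Or.inr (Or.inl h2)
    · push Not at h2
      exact Or.inr (Or.inr (mem_rest.2 ⟨h1, h2⟩))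

-- Some leaf is adjacent to no odd run

section EvenPosition

/-- The runs beside `x` are even or empty. Counting the following one from its end and the preceding
one from its beginning avoids both neighbours of `x` at no loss, so the general bound is attained.
-/
theorem exists_maximum_of_mem_evenPositions {x : V} (hx : x ∈ L) (hu : P x ∈ evenPositions B)
    {Z : ZMod g → Prop} (hZ : ∀ p, p ∉ B → p + 1 ∉ B → (Z p ↔ Z (p + 1)))
    (hZ1 : P x + 1 ∉ B → Z (P x + 1)) (hZ2 : P x - 1 ∉ B → ¬ Z (P x - 1)) :
    ∃ I : Finset V, S.IsMaximumIndepSet I ∧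
      I.card = (rest w B L).card + 1 + (canonical B).card ∧
      rest w B L ⊆ I ∧ x ∈ I ∧ ∀ p ∈ alternating B Z, w p ∈ I := by
  have hB : B.Nonempty := ⟨_, hu.1⟩
  obtain ⟨I, hI, hc, h1, h2, h3⟩ := M.exists_indepSet (T := alternating B Z) (l := {x})
    (fun p hp => (mem_alternating.1 hp).1) (fun p hp => alternating_succ hB hZ hp)
    (by simpa using hx) (by simp) (by
      intro y hy
      obtain rfl := Finset.mem_singleton.1 hy
      rw [mem_alternating, mem_alternating]
      constructor
      · rintro ⟨h1, ⟨-, h⟩ | ⟨h, -⟩⟩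
        · exact hu.2.1 h
        · exact h (hZ1 h1)
      · rintro ⟨h1, ⟨h, -⟩ | ⟨-, h⟩⟩
        · exact hZ2 h1 h
        · exact hu.2.2 h)
  have hle := card_canonical_le_alternating hB hZ
  have hup : ∀ J : Finset V, S.IsIndepSet J →
      J.card ≤ (rest w B L).card + 1 + (canonical B).card := by
    intro J hJ
    have := M.card_add_card_le hJ hB (E := ∅) (by simp)
    have := M.card_leafPart_le hJ
    simp only [Finset.card_empty] at *
    omega
  rw [Finset.card_singleton] at hc
  have hup' := hup I hI
  have hceq : I.card = (rest w B L).card + 1 + (canonical B).card := by omega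
  exact ⟨I, ⟨hI, fun J hJ => (hup J hJ).trans hceq.ge⟩, hceq, h1, h2 (by simp), h3⟩

variable {u b : ZMod g} (hu : u ∈ evenPositions B) (hb : b ∈ B) (hne : b ≠ u)

include hu hb hne

/-- Only the run following `u` is counted from its end. A second element `b` of `B` ensures that
this is not also the run preceding `u`. -/
theorem exists_maximum_start {x : V} (hx : x ∈ L) (hxu : P x = u) :
    ∃ I : Finset V, S.IsMaximumIndepSet I ∧
      I.card = (rest w B L).card + 1 + (canonical B).card ∧
      rest w B L ⊆ I ∧ x ∈ I ∧
      ∀ p ∈ alternating B (fun p => p - back B p = u), w p ∈ I := by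
  have hB : B.Nonempty := ⟨_, hb⟩
  subst hxu
  refine M.exists_maximum_of_mem_evenPositions hx hu (fun p _ hp => ?_) (fun h => ?_) (fun _ => ?_)
  · rw [add_one_sub_back hB hp]
  · rw [add_one_sub_back hB h, back_eq_zero hu.1]
    simp
  · exact pred_back_ne hb hne

/-- The opposite extreme: only the run preceding `u` is counted from its beginning. -/
theorem exists_maximum_end {x : V} (hx : x ∈ L) (hxu : P x = u) :
    ∃ I : Finset V, S.IsMaximumIndepSet I ∧
      I.card = (rest w B L).card + 1 + (canonical B).card ∧
      rest w B L ⊆ I ∧ x ∈ I ∧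
      ∀ p ∈ alternating B (fun p => p + fwd B p ≠ u), w p ∈ I := by
  have hB : B.Nonempty := ⟨_, hb⟩
  subst hxu
  refine M.exists_maximum_of_mem_evenPositions hx hu (fun p hp _ => ?_) (fun h => ?_) (fun h => ?_)
  · rw [add_fwd_add_one hB hp]
  · exact succ_fwd_ne hb hne
  · rw [not_not, fwd_sub_one hB h, fwd_eq_zero hu.1]
    simp

/-- The vertices in no maximum independent set, if some cycle vertex of degree at least three is
not adjacent to an odd run. -/
theorem forced_iff_of_mem_evenPositions (x : V) :
    (∀ I : Finset V, S.IsMaximumIndepSet I → x ∉ I) ↔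
      (x ∈ L ∧ (Odd (fwd B (P x + 1)) ∨ Odd (back B (P x - 1)))) ∨
      ∃ p, p ∉ B ∧ w p = x ∧ ((Even (back B p) ∧ Even (fwd B p)) ∨
        (Odd (back B p) ∧ Even (fwd B p) ∧ ∀ u ∈ evenPositions B, p - back B p = u) ∨
        (Even (back B p) ∧ Odd (fwd B p) ∧ ∀ u ∈ evenPositions B, p + fwd B p = u)) := by
  have hB : B.Nonempty := ⟨b, hb⟩
  have hother : ∀ u' : ZMod g, ∃ b' ∈ B, b' ≠ u' := fun u' => by
    by_cases h : b = u'
    · exact ⟨u, hu.1, h ▸ hne.symm⟩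
    · exact ⟨b, hb, h⟩
  constructor
  · intro h
    by_contra hcon
    rw [not_or] at hcon
    obtain ⟨y, hy, hyu⟩ := M.exists_leaf hu.1
    rcases mem_cases w B L x with hx | ⟨p, hp, rfl⟩ | hx
    · have hPx : P x ∈ evenPositions B := by
        refine ⟨M.root_mem hx, ?_⟩
        rw [← not_or]
        exact fun h => hcon.1 ⟨hx, h⟩
      obtain ⟨b', hb', hne'⟩ := hother (P x)
      obtain ⟨I, hI, -, -, hxI, -⟩ := M.exists_maximum_start hPx hb' hne' hx rfl
      exact h I hI hxI
    · have hcon := not_exists.1 hcon.2 p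
      simp only [hp, not_false_eq_true, true_and, not_or] at hcon
      obtain ⟨h1, h2, h3⟩ := hcon
      by_cases hbk : Odd (back B p)
      · by_cases hfw : Odd (fwd B p)
        · obtain ⟨I, hI, -, -, -, hpI⟩ := M.exists_maximum_start hu hb hne hy hyu
          refine h I hI (hpI p (mem_alternating.2 ⟨hp, ?_⟩))
          by_cases hs : p - back B p = u
          · exact Or.inl ⟨hs, hfw⟩
          · exact Or.inr ⟨hs, hbk⟩
        -- A leaf at some `u'` other than the start of this even run leaves the run free to be
        -- counted from its beginning.
        · have : ∃ u' ∈ evenPositions B, p - back B p ≠ u' := by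
            by_contra hc
            push Not at hc
            exact h2 ⟨hbk, Nat.not_odd_iff_even.1 hfw, hc⟩
          obtain ⟨u', hu', hs⟩ := this
          obtain ⟨b', hb', hne'⟩ := hother u'
          obtain ⟨y, hy, hyu⟩ := M.exists_leaf hu'.1
          obtain ⟨I, hI, -, -, -, hpI⟩ := M.exists_maximum_start hu' hb' hne' hy hyu
          exact h I hI (hpI p (mem_alternating.2 ⟨hp, Or.inr ⟨hs, hbk⟩⟩))
      · rw [Nat.not_odd_iff_even] at hbk
        have hfw : Odd (fwd B p) := by
          by_contra hfw
          exact h1 ⟨hbk, Nat.not_odd_iff_even.1 hfw⟩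
        have : ∃ u' ∈ evenPositions B, p + fwd B p ≠ u' := by
          by_contra hc
          push Not at hc
          exact h3 ⟨hbk, hfw, hc⟩
        obtain ⟨u', hu', hs⟩ := this
        obtain ⟨b', hb', hne'⟩ := hother u'
        obtain ⟨y, hy, hyu⟩ := M.exists_leaf hu'.1
        obtain ⟨I, hI, -, -, -, hpI⟩ := M.exists_maximum_end hu' hb' hne' hy hyu
        exact h I hI (hpI p (mem_alternating.2 ⟨hp, Or.inl ⟨hs, hfw⟩⟩))
    · obtain ⟨I, hI, -, hr, -, -⟩ := M.exists_maximum_start hu hb hne hy hyu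
      exact h I hI (hr hx)
  · intro h I hI hxI
    obtain ⟨y, hy, hyu⟩ := M.exists_leaf hu.1
    obtain ⟨J, hJ, hJc, -⟩ := M.exists_maximum_start hu hb hne hy hyu
    have hc : (rest w B L).card + 1 + (canonical B).card ≤ I.card := hJc ▸ hI.2 J hJ.1
    have hl1 := M.card_leafPart_le hI.1
    have hT : ∀ p ∈ positions w B I, p ∉ B := fun p hp => (mem_positions.1 hp).1
    have hind : ∀ p ∈ positions w B I, p + 1 ∉ positions w B I :=
      fun p hp => M.positions_succ hI.1 hp
    -- Since `I` attains the bound, no pair is missed; consequently `I` contains a leaf, and that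
    -- leaf is adjacent to no odd run.
    have hmiss : ∀ a, ¬ Missed B (positions w B I) a := by
      intro a ha
      have := M.card_add_card_le hI.1 hB (E := {a}) (by simpa using ha)
      rw [Finset.card_singleton] at this
      omega
    have hle := M.card_add_card_le hI.1 hB (E := ∅) (by simp)
    rw [Finset.card_empty] at hle
    have hleaf : ∀ z ∈ leafPart L I, P z ∈ evenPositions B := by
      intro z hz
      have hzB := M.root_mem (mem_leafPart.1 hz).2
      refine ⟨hzB, fun ho => ?_, fun ho => ?_⟩
      · obtain ⟨a, ha, -⟩ := exists_missed_succ hB hT hind hzB (M.succ_notMem_positions hI.1 hz) ho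
        exact hmiss a ha
      · exact hmiss _ (missed_pred hT hzB (M.pred_notMem_positions hI.1 hz) ho)
    obtain ⟨z, hz⟩ : (leafPart L I).Nonempty := Finset.card_pos.1 (by omega)
    have hzU := hleaf z hz
    rcases h with ⟨hx, ho⟩ | ⟨p, hp, rfl, ⟨hbk, hfw⟩ | ⟨hbk, -, hU⟩ | ⟨hbk, hfw, hU⟩⟩
    · have := hleaf x (mem_leafPart.2 ⟨hxI, hx⟩)
      exact ho.elim this.2.1 this.2.2
    · obtain ⟨a, ha, -⟩ := exists_missed hB hT hind (mem_positions.2 ⟨hp, hxI⟩) hbk hfw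
      exact hmiss a ha
    -- The leaf `z` excludes the first vertex of the following run. With no missed pair, the
    -- exclusion of one first member puts its partner in `I`, which excludes the next first member.
    · have key : ∀ n, ∀ p, p ∉ B → back B p = 2 * n + 1 → p - back B p = P z →
          p ∉ positions w B I := by
        intro n
        induction n with
        | zero =>
          intro p hp hn hs
          rw [hn] at hs
          have : p = P z + 1 := by rw [← hs]; simp
          rw [this]
          exact M.succ_notMem_positions hI.1 hz
        | succ n ih =>
          intro p hp hn hs hpT
          have e1 := back_eq_add_one hB hp
          have hp1 : p - 1 ∉ B := fun hm => by rw [back_eq_zero hm] at e1; omega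
          have e2 := back_eq_add_one hB hp1
          have hp2 : p - 1 - 1 ∉ B := fun hm => by rw [back_eq_zero hm] at e2; omega
          have h1 := ih (p - 1 - 1) hp2 (by omega) (by
            rw [← hs, e1, e2]
            push_cast
            ring)
          refine hmiss (p - 1 - 1) ⟨⟨n, by omega⟩, h1, fun h2 => ?_⟩
          rw [sub_add_cancel] at h2
          exact hind _ h2 (by rwa [sub_add_cancel])
      obtain ⟨n, hn⟩ := hbk
      exact key n p hp hn (hU _ hzU) (mem_positions.2 ⟨hp, hxI⟩)
    -- The mirror argument starts at the last vertex of the preceding run, excluded by `z`, and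
    -- moves backwards through the second members.
    · have key : ∀ n, ∀ p, p ∉ B → fwd B p = 2 * n + 1 → p + fwd B p = P z →
          Even (back B p) → p ∉ positions w B I := by
        intro n
        induction n with
        | zero =>
          intro p hp hn hs _
          rw [hn] at hs
          have : p = P z - 1 := by rw [← hs]; simp
          rw [this]
          exact M.pred_notMem_positions hI.1 hz
        | succ n ih =>
          intro p hp hn hs hev hpT
          have e1 := fwd_eq_add_one hB hp
          have hp1 : p + 1 ∉ B := fun hm => by rw [fwd_eq_zero hm] at e1; omega
          have e2 := fwd_eq_add_one hB hp1
          have hp2 : p + 1 + 1 ∉ B := fun hm => by rw [fwd_eq_zero hm] at e2; omega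
          have e3 := back_add_one hB hp1
          have e4 := back_add_one hB hp2
          have h1 := ih (p + 1 + 1) hp2 (by omega) (by
            rw [← hs, e1, e2]
            push_cast
            ring) (by rw [e4, e3]; exact hev.add_one.add_one)
          exact hmiss (p + 1) ⟨by rw [e3]; exact hev.add_one, hind p hpT, h1⟩
      obtain ⟨n, hn⟩ := hfw
      exact key n p hp hn (hU _ hzU) hbk (mem_positions.2 ⟨hp, hxI⟩)

end EvenPosition

end Counting

end CyclicModel

end OddUnicyclic

namespace OddUnicyclic

-- Every cycle vertex of degree at least three is beside an odd run

section Gaps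

variable {g : ℕ} [NeZero g] {B : Set (ZMod g)}

theorem not_odd_fwd_of_eq (hg : Odd g) (hB : B.Nonempty) {u : ZMod g}
    (h : u + 1 + fwd B (u + 1) = u) : ¬ Odd (fwd B (u + 1)) := by
  have h2 := fwd_lt hB (u + 1)
  have h3 : ((fwd B (u + 1) + 1 : ℕ) : ZMod g) = 0 := by
    push_cast
    linear_combination h
  have h4 := Nat.le_of_dvd (by omega) ((ZMod.natCast_eq_zero_iff _ _).1 h3)
  have h5 : fwd B (u + 1) + 1 = g := by omega
  rw [← h5] at hg
  intro h6
  exact Nat.not_even_iff_odd.2 hg h6.add_one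

theorem add_fwd_eq_of_sub_back_eq (hB : B.Nonempty) {p b : ZMod g} (hp : p ∉ B)
    (h : p - back B p = b) : p + fwd B p = b + 1 + fwd B (b + 1) := by
  induction hn : back B p generalizing p with
  | zero =>
    have := back_mem hB p
    rw [hn] at this
    simp at this
    contradiction
  | succ n ih =>
    have e1 := back_eq_add_one hB hp
    by_cases hp1 : p - 1 ∈ B
    · rw [e1, back_eq_zero hp1] at h
      have : p = b + 1 := by rw [← h]; simp
      rw [this]
    · rw [← ih hp1 (by rw [← h, e1]; push_cast; ring) (by omega), ← add_fwd_add_one hB hp1,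
        sub_add_cancel]

end Gaps

namespace CyclicModel

variable {V : Type*} {S : SimpleGraph V} {g : ℕ} {w : ZMod g → V} {B : Set (ZMod g)}
  {L : Set V} {P : V → ZMod g} [Fintype V] (M : CyclicModel S w B L P)

section NoEvenPosition

variable [NeZero g] (hg : Odd g) (hB : B.Nonempty) (hU : evenPositions B = ∅)

include hU in
omit [NeZero g] in
theorem odd_or_odd {b : ZMod g} (hb : b ∈ B) : Odd (fwd B (b + 1)) ∨ Odd (back B (b - 1)) := by
  by_contra h
  rw [not_or] at h
  have : b ∈ evenPositions B := ⟨hb, h⟩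
  rw [hU] at this
  exact this

include M hB hU

/-- A leaf in `I` makes it avoid an end of an odd run, and the missed pair cancels the leaf. -/
theorem card_le_of_evenPositions_eq_empty {I : Finset V} (hI : S.IsIndepSet I) :
    I.card ≤ (rest w B L).card + (canonical B).card := by
  have hT : ∀ p ∈ positions w B I, p ∉ B := fun p hp => (mem_positions.1 hp).1
  have hind : ∀ p ∈ positions w B I, p + 1 ∉ positions w B I :=
    fun p hp => M.positions_succ hI hp
  rcases (leafPart L I).eq_empty_or_nonempty with h | ⟨z, hz⟩
  · have := M.card_add_card_le hI hB (E := ∅) (by simp)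
    rw [h, Finset.card_empty, Finset.card_empty] at this
    omega
  · have hzB := M.root_mem (mem_leafPart.1 hz).2
    have : ∃ a, Missed B (positions w B I) a := by
      rcases odd_or_odd hU hzB with ho | ho
      · obtain ⟨a, ha, -⟩ := exists_missed_succ hB hT hind hzB (M.succ_notMem_positions hI hz) ho
        exact ⟨a, ha⟩
      · exact ⟨_, missed_pred hT hzB (M.pred_notMem_positions hI hz) ho⟩
    obtain ⟨a, ha⟩ := this
    have h1 := M.card_add_card_le hI hB (E := {a}) (by simpa using ha)
    have h2 := M.card_leafPart_le hI
    rw [Finset.card_singleton] at h1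
    omega

theorem isMaximum_of_le_card {I : Finset V} (hI : S.IsIndepSet I)
    (h : (rest w B L).card + (canonical B).card ≤ I.card) : S.IsMaximumIndepSet I :=
  ⟨hI, fun _ hJ => (M.card_le_of_evenPositions_eq_empty hB hU hJ).trans h⟩

/-- No leaf is used; all runs are counted from the end or all from the beginning, according to `c`.
-/
theorem exists_maximum_of_const (c : Prop) :
    ∃ I : Finset V, S.IsMaximumIndepSet I ∧
      (rest w B L).card + (canonical B).card ≤ I.card ∧
      rest w B L ⊆ I ∧ ∀ p ∈ alternating B (fun _ => c), w p ∈ I := by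
  obtain ⟨I, hI, hc, h1, -, h3⟩ := M.exists_indepSet (T := alternating B fun _ => c) (l := ∅)
    (fun p hp => (mem_alternating.1 hp).1)
    (fun p hp => alternating_succ hB (fun _ _ _ => Iff.rfl) hp) (by simp) (by simp) (by simp)
  have hle := card_canonical_le_alternating hB (Z := fun _ => c) (fun _ _ _ => Iff.rfl)
  rw [Finset.card_empty] at hc
  exact ⟨I, M.isMaximum_of_le_card hB hU hI (by omega), by omega, h1, h3⟩

/-- The run preceding `x` is odd. Exchanging A_1 for A_2 there loses one vertex, which the leaf `x`
makes up for. Counting the other runs from the end avoids the first vertex of the run after `x`. -/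
theorem exists_maximum_of_not_odd_fwd {x : V} (hx : x ∈ L) (ho : ¬ Odd (fwd B (P x + 1))) :
    ∃ I : Finset V, S.IsMaximumIndepSet I ∧ x ∈ I ∧
      ∀ p, p ∉ B → p + fwd B p = P x → Even (back B p) → w p ∈ I := by
  classical
  have hb := M.root_mem hx
  set b := P x with hbdef
  have hoL := (odd_or_odd hU hb).resolve_left ho
  set T : Finset (ZMod g) := Finset.univ.filter fun p => p ∉ B ∧
    ((p + fwd B p = b ∧ Even (back B p)) ∨ (p + fwd B p ≠ b ∧ Odd (fwd B p))) with hTdef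
  have hT : ∀ p, p ∈ T ↔ p ∉ B ∧
      ((p + fwd B p = b ∧ Even (back B p)) ∨ (p + fwd B p ≠ b ∧ Odd (fwd B p))) := by
    simp [hTdef]
  obtain ⟨I, hI, hc, -, h2, h3⟩ := M.exists_indepSet (T := T) (l := {x})
    (fun p hp => ((hT p).1 hp).1) (fun p hp hq => by
      rw [hT] at hp hq
      rw [add_fwd_add_one hB hp.1, back_add_one hB hq.1] at hq
      rcases hp.2 with ⟨h1, h2⟩ | ⟨h1, h2⟩ <;> rcases hq.2 with ⟨h3, h4⟩ | ⟨h3, h4⟩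
      · exact Nat.even_add_one.1 h4 h2
      · exact h3 h1
      · exact h1 h3
      · rw [fwd_eq_add_one hB hp.1] at h2
        exact Nat.odd_add_one.1 h2 h4)
    (by simpa using hx) (by simp) (by
      intro y hy
      obtain rfl := Finset.mem_singleton.1 hy
      rw [hT, hT]
      constructor
      · rintro ⟨h1, ⟨-, h⟩ | ⟨-, h⟩⟩
        · rw [back_add_one hB h1, back_eq_zero hb] at h
          exact absurd h (by decide)
        · exact ho h
      · rintro ⟨h1, ⟨-, h⟩ | ⟨h, -⟩⟩
        · exact Nat.not_even_iff_odd.2 hoL h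
        · refine h ?_
          rw [fwd_sub_one hB h1, fwd_eq_zero hb]
          simp [hbdef])
  -- The only pair lost is that of the last vertex `b - 1` of the odd run.
  have hle := card_canonical_le (B := B) (T := T) (E := {b - 1}) (fun a ha haE => by
    have haB := notMem_of_odd_back ha
    rw [Finset.mem_singleton] at haE
    rw [hT, hT]
    by_cases he : a + fwd B a = b
    · right
      have h1 : a + 1 ∉ B := fun h => haE (by
        rw [fwd_eq_add_one hB haB, fwd_eq_zero h] at he
        rw [← he]
        simp)
      have h2 : Even (back B (a + 1)) := by
        rw [back_add_one hB h1]
        exact ha.add_one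
      exact ⟨⟨h1, Or.inl ⟨by rw [add_fwd_add_one hB haB, he], h2⟩⟩, h2⟩
    · by_cases hf : Odd (fwd B a)
      · exact Or.inl ⟨haB, Or.inr ⟨he, hf⟩⟩
      · right
        have h1 := add_one_notMem hB haB (Nat.not_odd_iff_even.1 hf)
        refine ⟨⟨h1, Or.inr ⟨by rwa [add_fwd_add_one hB haB], ?_⟩⟩, ?_⟩
        · rwa [fwd_eq_add_one hB haB, Nat.odd_add_one, not_not] at hf
        · rw [back_add_one hB h1]
          exact ha.add_one)
  rw [Finset.card_singleton] at hc hle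
  exact ⟨I, M.isMaximum_of_le_card hB hU hI (by omega), h2 (by simp),
    fun p hp he hbk => h3 p ((hT p).2 ⟨hp, Or.inl ⟨he, hbk⟩⟩)⟩

include hg

theorem exists_maximum_of_not_odd_back {x : V} (hx : x ∈ L) (ho : ¬ Odd (back B (P x - 1))) :
    ∃ I : Finset V, S.IsMaximumIndepSet I ∧ x ∈ I ∧
      ∀ p, p ∉ B → p - back B p = P x → Even (back B p) → w p ∈ I := by
  classical
  have hb := M.root_mem hx
  set b := P x with hbdef
  have hoR := (odd_or_odd hU hb).resolve_right ho
  set T : Finset (ZMod g) := Finset.univ.filter fun p => p ∉ B ∧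
    ((p - back B p = b ∧ Even (back B p)) ∨ (p - back B p ≠ b ∧ Odd (back B p))) with hTdef
  have hT : ∀ p, p ∈ T ↔ p ∉ B ∧
      ((p - back B p = b ∧ Even (back B p)) ∨ (p - back B p ≠ b ∧ Odd (back B p))) := by
    simp [hTdef]
  obtain ⟨I, hI, hc, -, h2, h3⟩ := M.exists_indepSet (T := T) (l := {x})
    (fun p hp => ((hT p).1 hp).1) (fun p hp hq => by
      rw [hT] at hp hq
      rw [add_one_sub_back hB hq.1, back_add_one hB hq.1] at hq
      rcases hp.2 with ⟨h1, h2⟩ | ⟨h1, h2⟩ <;> rcases hq.2 with ⟨h3, h4⟩ | ⟨h3, h4⟩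
      · exact Nat.even_add_one.1 h4 h2
      · exact h3 h1
      · exact h1 h3
      · exact Nat.odd_add_one.1 h4 h2)
    (by simpa using hx) (by simp) (by
      intro y hy
      obtain rfl := Finset.mem_singleton.1 hy
      rw [hT, hT]
      constructor
      · rintro ⟨h1, ⟨-, h⟩ | ⟨h, -⟩⟩
        · rw [back_add_one hB h1, back_eq_zero hb] at h
          exact absurd h (by decide)
        · refine h ?_
          rw [add_one_sub_back hB h1, back_eq_zero hb]
          simp [hbdef]
      · rintro ⟨h1, ⟨h, -⟩ | ⟨-, h⟩⟩
        -- The runs before and after `b` are distinct, since otherwise their common length g - 1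
        -- would be odd.
        · exact pred_back_ne (fwd_mem hB (b + 1)) (fun h => not_odd_fwd_of_eq hg hB h hoR) h
        · exact ho h)
  -- The pair lost is again that of the last vertex of the odd run, now the one following `b`.
  have hle := card_canonical_le (B := B) (T := T) (E := {b + 1 + fwd B (b + 1) - 1})
    (fun a ha haE => by
      have haB := notMem_of_odd_back ha
      rw [Finset.mem_singleton] at haE
      rw [hT, hT]
      by_cases hs : a - back B a = b
      · right
        have h1 : a + 1 ∉ B := fun h => haE (by
          rw [← add_fwd_eq_of_sub_back_eq hB haB hs, fwd_eq_add_one hB haB, fwd_eq_zero h]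
          simp)
        have h2 : Even (back B (a + 1)) := by
          rw [back_add_one hB h1]
          exact ha.add_one
        exact ⟨⟨h1, Or.inl ⟨by rw [add_one_sub_back hB h1, hs], h2⟩⟩, h2⟩
      · exact Or.inl ⟨haB, Or.inr ⟨hs, ha⟩⟩)
  rw [Finset.card_singleton] at hc hle
  exact ⟨I, M.isMaximum_of_le_card hB hU hI (by omega), h2 (by simp),
    fun p hp hs hbk => h3 p ((hT p).2 ⟨hp, Or.inl ⟨hs, hbk⟩⟩)⟩

/-- The vertices in no maximum independent set, if every cycle vertex of degree at least three is
adjacent to an odd run. -/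
theorem forced_iff_of_evenPositions_eq_empty (x : V) :
    (∀ I : Finset V, S.IsMaximumIndepSet I → x ∉ I) ↔
      (x ∈ L ∧ Odd (fwd B (P x + 1)) ∧ Odd (back B (P x - 1))) ∨
      ∃ p, p ∉ B ∧ w p = x ∧ Even (back B p) ∧ Even (fwd B p) ∧
        Odd (back B (p - back B p - 1)) ∧ Odd (fwd B (p + fwd B p + 1)) := by
  constructor
  · intro h
    by_contra hcon
    rw [not_or] at hcon
    rcases mem_cases w B L x with hx | ⟨p, hp, rfl⟩ | hx
    · by_cases ho : Odd (fwd B (P x + 1))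
      · obtain ⟨I, hI, hxI, -⟩ := M.exists_maximum_of_not_odd_back hg hB hU hx
          (fun ho' => hcon.1 ⟨hx, ho, ho'⟩)
        exact h I hI hxI
      · obtain ⟨I, hI, hxI, -⟩ := M.exists_maximum_of_not_odd_fwd hB hU hx ho
        exact h I hI hxI
    · by_cases hbk : Odd (back B p)
      · obtain ⟨I, hI, -, -, hpI⟩ := M.exists_maximum_of_const hB hU False
        exact h I hI (hpI p (mem_alternating.2 ⟨hp, Or.inr ⟨id, hbk⟩⟩))
      by_cases hfw : Odd (fwd B p)
      · obtain ⟨I, hI, -, -, hpI⟩ := M.exists_maximum_of_const hB hU True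
        exact h I hI (hpI p (mem_alternating.2 ⟨hp, Or.inl ⟨trivial, hfw⟩⟩))
      rw [Nat.not_odd_iff_even] at hbk hfw
      by_cases ho : Odd (fwd B (p + fwd B p + 1))
      · obtain ⟨z, hz, hzs⟩ := M.exists_leaf (back_mem hB p)
        obtain ⟨I, hI, -, hpI⟩ := M.exists_maximum_of_not_odd_back hg hB hU hz
          (fun ho' => hcon.2 ⟨p, hp, rfl, hbk, hfw, by rwa [← hzs], ho⟩)
        exact h I hI (hpI p hp hzs.symm hbk)
      · obtain ⟨z, hz, hze⟩ := M.exists_leaf (fwd_mem hB p)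
        obtain ⟨I, hI, -, hpI⟩ := M.exists_maximum_of_not_odd_fwd hB hU hz (by rwa [hze])
        exact h I hI (hpI p hp hze.symm hbk)
    · obtain ⟨I, hI, -, hr, -⟩ := M.exists_maximum_of_const hB hU False
      exact h I hI (hr hx)
  · intro h I hI hxI
    obtain ⟨J, hJ, hJc, -⟩ := M.exists_maximum_of_const hB hU False
    have hc := hJc.trans (hI.2 J hJ.1)
    have hl1 := M.card_leafPart_le hI.1
    have hT : ∀ p ∈ positions w B I, p ∉ B := fun p hp => (mem_positions.1 hp).1
    have hind : ∀ p ∈ positions w B I, p + 1 ∉ positions w B I :=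
      fun p hp => M.positions_succ hI.1 hp
    -- A maximum set has room for one missed pair at most, compensated by a leaf. A leaf between two
    -- odd runs would miss a pair in each.
    have hmiss : ∀ a a', Missed B (positions w B I) a → Missed B (positions w B I) a' →
        a = a' := by
      intro a a' ha ha'
      by_contra hne
      have := M.card_add_card_le hI.1 hB (E := {a, a'}) (by
        intro e he
        rw [Finset.mem_insert, Finset.mem_singleton] at he
        rcases he with rfl | rfl <;> assumption)
      rw [Finset.card_pair hne] at this
      omega
    have hleaf : ∀ z ∈ leafPart L I,
        ¬ (Odd (fwd B (P z + 1)) ∧ Odd (back B (P z - 1))) := by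
      rintro z hz ⟨ho1, ho2⟩
      have hzB := M.root_mem (mem_leafPart.1 hz).2
      obtain ⟨a, ha, has⟩ :=
        exists_missed_succ hB hT hind hzB (M.succ_notMem_positions hI.1 hz) ho1
      have ha' := missed_pred hT hzB (M.pred_notMem_positions hI.1 hz) ho2
      obtain rfl := hmiss _ _ ha ha'
      exact not_odd_back_of_eq hg hB has ho2
    rcases h with ⟨hx, ho⟩ | ⟨p, hp, rfl, hbk, hfw, ho1, ho2⟩
    · exact hleaf x (mem_leafPart.2 ⟨hxI, hx⟩) ho
    · obtain ⟨a, ha, has, hae⟩ := exists_missed hB hT hind (mem_positions.2 ⟨hp, hxI⟩) hbk hfw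
      -- The vertex `p` of A_2 already causes a missed pair, so `I` contains a leaf. The pair missed
      -- because of that leaf must be the same one, so the leaf is at an end of this run; the
      -- hypotheses then put it between two odd runs.
      rcases (leafPart L I).eq_empty_or_nonempty with he | ⟨z, hz⟩
      · have := M.card_add_card_le hI.1 hB (E := {a}) (by simpa using ha)
        rw [he, Finset.card_empty, Finset.card_singleton] at this
        omega
      · have hzB := M.root_mem (mem_leafPart.1 hz).2
        refine hleaf z hz ?_
        rcases odd_or_odd hU hzB with ho | ho
        · obtain ⟨a', ha', has'⟩ :=
            exists_missed_succ hB hT hind hzB (M.succ_notMem_positions hI.1 hz) ho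
          obtain rfl := hmiss _ _ ha ha'
          rw [← has, has'] at ho1
          exact ⟨ho, ho1⟩
        · have ha' := missed_pred hT hzB (M.pred_notMem_positions hI.1 hz) ho
          obtain rfl := hmiss _ _ ha ha'
          rw [fwd_sub_one hB (notMem_of_odd_back ho), fwd_eq_zero hzB] at hae
          rw [← hae] at ho2
          refine ⟨?_, ho⟩
          simpa using ho2

end NoEvenPosition

/-- If all cycle vertices have degree two, every vertex is in some maximum independent set. -/
theorem exists_maximum_of_eq_empty [NeZero g] (M : CyclicModel S w ∅ L P) (x : V) :
    ∃ I : Finset V, S.IsMaximumIndepSet I ∧ x ∈ I := by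
  classical
  have hL : ∀ y, y ∉ L := fun y hy => M.root_mem hy
  have hadj : ∀ p q, S.Adj (w p) (w q) ↔ q = p + 1 ∨ p = q + 1 := fun p q =>
    M.adj_iff (fun h => h) (fun h => h)
  have hsupp : ∀ {y z}, S.Adj y z → y ∈ Set.range w := fun h => by
    rcases M.mem_of_adj h with h | ⟨p, -, h⟩
    · exact absurd h (hL _)
    · exact ⟨p, h⟩
  obtain ⟨I, hI⟩ := S.maximumIndepSet_exists
  -- A maximum independent set absorbs every vertex without neighbours in it.
  have hins : ∀ y, (∀ z ∈ I, ¬ S.Adj y z) → y ∈ I := by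
    intro y hy
    by_contra hyI
    have h1 := hI.2 (insert y I) (by
      rw [Finset.coe_insert]
      refine Set.Pairwise.insert hI.1 fun z hz _ => ⟨hy z hz, fun h => hy z hz h.symm⟩)
    rw [Finset.card_insert_of_notMem hyI] at h1
    omega
  by_cases hx : x ∈ Set.range w
  · obtain ⟨p, rfl⟩ := hx
    have : ∃ q, w q ∈ I := by
      by_contra hc
      push Not at hc
      refine hc p (hins _ fun z hz h => ?_)
      obtain ⟨q, rfl⟩ := hsupp h.symm
      exact hc q hz
    obtain ⟨q, hq⟩ := this
    -- With `B` empty the strong resolving graph is a cycle plus isolated vertices. This rotation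
    -- takes `w q` to `w p` and fixes everything else off the cycle.
    set σ := (Equiv.addRight (p - q)).viaFintypeEmbedding ⟨w, M.injective⟩ with hσ
    have hσw : ∀ r, σ (w r) = w (r + (p - q)) := fun r =>
      Equiv.Perm.viaFintypeEmbedding_apply_image (Equiv.addRight (p - q)) ⟨w, M.injective⟩ r
    have hσn : ∀ y, y ∉ Set.range w → σ y = y := fun y hy =>
      Equiv.Perm.viaFintypeEmbedding_apply_notMem_range (Equiv.addRight (p - q))
        ⟨w, M.injective⟩ hy
    have hσadj : ∀ y z, S.Adj (σ y) (σ z) → S.Adj y z := by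
      intro y z h
      have hr : ∀ y z, S.Adj (σ y) (σ z) → y ∈ Set.range w := by
        intro y z h
        by_contra hy
        rw [hσn y hy] at h
        exact hy (hsupp h)
      obtain ⟨r, rfl⟩ := hr y z h
      obtain ⟨s, rfl⟩ := hr _ _ h.symm
      rw [hσw, hσw, hadj] at h
      rw [hadj]
      rcases h with h | h
      · left; linear_combination h
      · right; linear_combination h
    refine ⟨I.map σ.toEmbedding, ⟨?_, ?_⟩, ?_⟩
    · intro y hy z hz hne h
      rw [Finset.mem_coe, Finset.mem_map] at hy hz
      obtain ⟨y, hy, rfl⟩ := hy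
      obtain ⟨z, hz, rfl⟩ := hz
      have h' := hσadj y z h
      exact hI.1 hy hz h'.ne h'
    · intro J hJ
      rw [Finset.card_map]
      exact hI.2 J hJ
    · refine Finset.mem_map.2 ⟨w q, hq, ?_⟩
      change σ (w q) = w p
      rw [hσw]
      congr 1
      ring
  · exact ⟨I, hI, hins x fun z _ h => hx (hsupp h)⟩

end CyclicModel

end OddUnicyclic

namespace OddUnicyclic

-- Runs as maximal sequences

section Gaps

variable {g : ℕ} [NeZero g] {B : Set (ZMod g)} (hB : B.Nonempty)

include hB

theorem run_add {s : ZMod g} (hs : s - 1 ∈ B) {k : ℕ} (hk : k < fwd B s) :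
    s + k ∉ B ∧ back B (s + k) = k + 1 ∧ fwd B (s + k) + k = fwd B s := by
  have hn : ∀ j < fwd B s, s + (j : ℕ) ∉ B := fun j hj h => absurd (fwd_le h) (not_le.2 hj)
  refine ⟨hn k hk, ?_⟩
  induction k with
  | zero =>
    have h0 : s ∉ B := by simpa using hn 0 hk
    simp [back_eq_add_one hB h0, back_eq_zero hs]
  | succ k ih =>
    have ih := ih (by omega)
    have h1 := hn (k + 1) hk
    have h2 := hn k (by omega)
    push_cast at h1 ⊢
    rw [← add_assoc] at h1 ⊢
    have h3 := back_add_one hB h1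
    have h4 := fwd_eq_add_one hB h2
    omega

theorem exists_run {p : ZMod g} (hp : p ∉ B) :
    ∃ (s : ZMod g) (k : ℕ), s - 1 ∈ B ∧ s ∉ B ∧ k < fwd B s ∧ s + k = p ∧
      back B p = k + 1 ∧ fwd B p + k = fwd B s := by
  have e := back_eq_add_one hB hp
  have hmem := back_mem hB p
  rw [e] at hmem
  set k := back B (p - 1)
  have hs1 : p - (k : ZMod g) - 1 ∈ B := by
    push_cast at hmem
    rwa [← sub_sub] at hmem
  have hsB : p - (k : ZMod g) ∉ B := fun h => by
    have := back_le h
    omega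
  have hk : k < fwd B (p - (k : ZMod g)) := by
    by_contra hle
    rw [not_lt] at hle
    have h1 := fwd_mem hB (p - (k : ZMod g))
    have h2 : back B p ≤ k - fwd B (p - (k : ZMod g)) := back_le (by
      rw [Nat.cast_sub hle]
      convert h1 using 1
      ring)
    omega
  have h := run_add hB hs1 hk
  rw [sub_add_cancel] at h
  exact ⟨p - (k : ZMod g), k, hs1, hsB, hk, by ring, h.2⟩

end Gaps

/-- The neighbours of `x` are next to its root, where one of the two step counts is 1, so they are
ends of runs. -/
theorem CyclicModel.adj_run {V : Type*} {S : SimpleGraph V} {g : ℕ} [NeZero g] {w : ZMod g → V}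
    {B : Set (ZMod g)} {L : Set V} {P : V → ZMod g} (M : CyclicModel S w B L P)
    {s : ZMod g} {k : ℕ} (hs : s - 1 ∈ B) (hk : k < fwd B s) {x : V} (hx : x ∈ L)
    (h : S.Adj x (w (s + k))) :
    (s = P x + 1 ∧ k = 0) ∨ (s + fwd B s = P x ∧ k + 1 = fwd B s) := by
  have hB : B.Nonempty := ⟨_, hs⟩
  obtain ⟨h1, h2, h3⟩ := run_add hB hs hk
  rcases (M.leaf_adj_iff hx h1).1 h with h | h
  · left
    rw [h, back_add_one hB (by rwa [← h]), back_eq_zero (M.root_mem hx)] at h2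
    obtain rfl : k = 0 := by omega
    exact ⟨by simpa using h, rfl⟩
  · right
    have h4 : P x - 1 ∉ B := by rwa [← h]
    rw [h, fwd_sub_one hB h4, fwd_eq_zero (M.root_mem hx)] at h3
    refine ⟨?_, by omega⟩
    rw [← h3]
    push_cast
    linear_combination h

section Translation

variable {V : Type*} [Fintype V] {G : SimpleGraph V} [DecidableRel G.Adj]
  {g : ℕ} {v : ZMod g → V}

omit [Fintype V] in
theorem seqTerm_eq (hg : Odd g) (i : ZMod g) (k : ℕ) :
    seqTerm v i k = antipodalOrder v (2 * i + k) := by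
  unfold seqTerm antipodalOrder
  congr 1
  linear_combination -i * two_mul_half hg

variable (hG : IsUnicyclic G) (hg : Odd g) (hv : IsCycleLabelling G g v)

include hv in
theorem notMem_branchPositions_iff (p : ZMod g) :
    p ∉ branchPositions G v ↔ G.degree (antipodalOrder v p) = 2 := by
  have : 2 ≤ G.degree (antipodalOrder v p) := two_le_degree hv _
  change ¬ 3 ≤ _ ↔ _
  omega

include hG hg hv

theorem isSequence_iff (i : ZMod g) (q : ℕ) : IsSequence G v i q ↔
    1 ≤ q ∧ q ≤ g ∧ ∀ k < q, 2 * i + (k : ℕ) ∉ branchPositions G v := by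
  have M := cyclicModel hG hg hv
  have hdeg : ∀ k : ℕ, 2 * i + (k : ℕ) ∉ branchPositions G v ↔ G.degree (seqTerm v i k) = 2 := by
    intro k
    rw [notMem_branchPositions_iff hv, ← seqTerm_eq hg]
  unfold IsSequence
  simp only [← hdeg, seqTerm_eq hg]
  constructor
  · rintro ⟨h1, h2, h3, -⟩
    exact ⟨h1, h2, h3⟩
  · rintro ⟨h1, h2, h3⟩
    refine ⟨h1, h2, h3, fun k hk => (M.adj_iff (h3 k (by omega)) (h3 (k + 1) hk)).2 (Or.inl ?_)⟩
    push_cast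
    ring

/-- Since `B` is met within `g` steps, sequences are shorter than `g`, and the bound on the length
never prevents a prolongation. -/
theorem isMaximalSequence_iff [NeZero g] (hB : (branchPositions G v).Nonempty) (i : ZMod g)
    (q : ℕ) : IsMaximalSequence G v i q ↔ 2 * i - 1 ∈ branchPositions G v ∧
      2 * i ∉ branchPositions G v ∧ q = fwd (branchPositions G v) (2 * i) := by
  have hi : 2 * (i - (((g + 1) / 2 : ℕ) : ZMod g)) = 2 * i - 1 := by
    linear_combination -two_mul_half hg
  unfold IsMaximalSequence
  simp only [isSequence_iff hG hg hv, hi]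
  have hlt := fwd_lt hB (2 * i)
  have hmem := fwd_mem hB (2 * i)
  constructor
  · rintro ⟨⟨h1, h2, h3⟩, h4, h5⟩
    have hqg : q < g := by
      by_contra hc
      exact h3 _ (by omega) hmem
    have h0 := h3 0 (by omega)
    rw [Nat.cast_zero, add_zero] at h0
    have hq : 2 * i + (q : ℕ) ∈ branchPositions G v := by
      by_contra hc
      refine h4 ⟨by omega, by omega, fun k hk => ?_⟩
      rcases Nat.lt_succ_iff_lt_or_eq.1 hk with h | rfl
      · exact h3 k h
      · exact hc
    refine ⟨?_, h0, le_antisymm ?_ (fwd_le hq)⟩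
    · by_contra hc
      refine h5 ⟨by omega, by omega, fun k hk => ?_⟩
      cases k with
      | zero => simpa using hc
      | succ k =>
        have := h3 k (by omega)
        push_cast
        rwa [show 2 * i - 1 + ((k : ZMod g) + 1) = 2 * i + k by ring]
    · by_contra hc
      exact h3 _ (not_le.1 hc) hmem
  · rintro ⟨h1, h2, rfl⟩
    have hpos := fwd_eq_add_one hB h2
    refine ⟨⟨by omega, hlt.le, fun k hk => (run_add hB h1 hk).1⟩, ?_, ?_⟩
    · rintro ⟨-, -, h⟩
      exact h _ (Nat.lt_succ_self _) hmem
    · rintro ⟨-, -, h⟩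
      exact h 0 (by omega) (by simpa using h1)

/-- The maximal sequence at the run starting at position `s`. -/
theorem isMaximalSequence_run [NeZero g] {s : ZMod g} (h1 : s - 1 ∈ branchPositions G v)
    (h2 : s ∉ branchPositions G v) :
    IsMaximalSequence G v (s * (((g + 1) / 2 : ℕ) : ZMod g)) (fwd (branchPositions G v) s) := by
  have hs : 2 * (s * (((g + 1) / 2 : ℕ) : ZMod g)) = s := by
    linear_combination s * two_mul_half hg
  rw [isMaximalSequence_iff hG hg hv ⟨_, h1⟩, hs]
  exact ⟨h1, h2, rfl⟩

omit [Fintype V] [DecidableRel G.Adj] hG hv in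
theorem seqTerm_run (v : ZMod g → V) (s : ZMod g) (k : ℕ) :
    seqTerm v (s * (((g + 1) / 2 : ℕ) : ZMod g)) k = antipodalOrder v (s + k) := by
  rw [seqTerm_eq hg]
  congr 2
  linear_combination s * two_mul_half hg

theorem leavesAt_eq (b : ZMod g) : leavesAt G v (antipodalOrder v b) =
    {x | x ∈ leafSet G ∧ leafPosition hG.1 v x = b} := by
  have h2 := two_mul_half hg
  ext x
  constructor
  · rintro ⟨h, hr⟩
    refine ⟨h, ?_⟩
    unfold leafPosition
    rw [root_eq hG hv hr]
    linear_combination b * h2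
  · rintro ⟨h, rfl⟩
    refine ⟨h, ?_⟩
    unfold leafPosition antipodalOrder
    rw [show 2 * root hG.1 v x * (((g + 1) / 2 : ℕ) : ZMod g) = root hG.1 v x by
      linear_combination root hG.1 v x * h2]
    exact root_reachable hG.1 v x

end Translation

end OddUnicyclic

namespace OddUnicyclic

-- The sets of the theorem in terms of positions

section Translation

variable {V : Type*} [Fintype V] {G : SimpleGraph V} [DecidableRel G.Adj]
  {g : ℕ} [NeZero g] {v : ZMod g → V}

variable (hG : IsUnicyclic G) (hg : Odd g) (hv : IsCycleLabelling G g v)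

include hG hg hv

/-- A leaf adjacent to a maximal sequence hangs next to its first or its last vertex. -/
theorem adj_seqTerm_cases {i : ZMod g} {q k : ℕ} (hB : (branchPositions G v).Nonempty)
    (hQ : IsMaximalSequence G v i q) (hk : k < q) {x : V} (hx : x ∈ leafSet G)
    (h : (strongResolvingGraph G).Adj x (seqTerm v i k)) :
    (2 * i = leafPosition hG.1 v x + 1 ∧ k = 0 ∧
      q = fwd (branchPositions G v) (leafPosition hG.1 v x + 1)) ∨
    (2 * i + q = leafPosition hG.1 v x ∧ k + 1 = q ∧
      q = back (branchPositions G v) (leafPosition hG.1 v x - 1)) := by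
  obtain ⟨h1, h2, rfl⟩ := (isMaximalSequence_iff hG hg hv hB i q).1 hQ
  rw [seqTerm_eq hg] at h
  rcases (cyclicModel hG hg hv).adj_run h1 hk hx h with ⟨h3, h4⟩ | ⟨h3, h4⟩
  · exact Or.inl ⟨h3, h4, by rw [h3]⟩
  · refine Or.inr ⟨h3, h4, ?_⟩
    rw [show leafPosition hG.1 v x - 1 = 2 * i + k by rw [← h3, ← h4]; push_cast; ring,
      (run_add hB h1 hk).2.1, h4]

/-- The run after a branch position. -/
theorem exists_isMaximalSequence_succ {x : V} (hx : x ∈ leafSet G)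
    (h : leafPosition hG.1 v x + 1 ∉ branchPositions G v) :
    ∃ i, 2 * i = leafPosition hG.1 v x + 1 ∧
      IsMaximalSequence G v i (fwd (branchPositions G v) (leafPosition hG.1 v x + 1)) ∧
      0 < fwd (branchPositions G v) (leafPosition hG.1 v x + 1) ∧
      (strongResolvingGraph G).Adj x (seqTerm v i 0) := by
  have M := cyclicModel hG hg hv
  have hb := M.root_mem hx
  set b := leafPosition hG.1 v x with hbdef
  refine ⟨_, ?_, isMaximalSequence_run hG hg hv (by rwa [add_sub_cancel_right]) h, ?_, ?_⟩
  · linear_combination (b + 1) * two_mul_half hg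
  · rw [fwd_eq_add_one ⟨_, hb⟩ h]
    omega
  · rw [seqTerm_run hg, Nat.cast_zero, add_zero, M.leaf_adj_iff hx h]
    exact Or.inl rfl

/-- The run before a branch position. -/
theorem exists_isMaximalSequence_pred {x : V} (hx : x ∈ leafSet G)
    (h : leafPosition hG.1 v x - 1 ∉ branchPositions G v) :
    ∃ i, 2 * i + back (branchPositions G v) (leafPosition hG.1 v x - 1) =
        leafPosition hG.1 v x ∧
      IsMaximalSequence G v i (back (branchPositions G v) (leafPosition hG.1 v x - 1)) ∧
      0 < back (branchPositions G v) (leafPosition hG.1 v x - 1) ∧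
      (strongResolvingGraph G).Adj x
        (seqTerm v i (back (branchPositions G v) (leafPosition hG.1 v x - 1) - 1)) := by
  have M := cyclicModel hG hg hv
  have hb := M.root_mem hx
  have hB : (branchPositions G v).Nonempty := ⟨_, hb⟩
  set b := leafPosition hG.1 v x with hbdef
  obtain ⟨s, k, h1, h2, hk, hs, hbk, hfk⟩ := exists_run hB h
  rw [fwd_sub_one hB h, fwd_eq_zero hb] at hfk
  have hfs : fwd (branchPositions G v) s = k + 1 := by omega
  have hmax := isMaximalSequence_run hG hg hv h1 h2
  rw [hfs] at hmax
  rw [hbk]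
  refine ⟨_, ?_, hmax, by omega, ?_⟩
  · push_cast
    linear_combination s * two_mul_half hg + hs
  · rw [seqTerm_run hg, Nat.add_sub_cancel, hs, M.leaf_adj_iff hx h]
    exact Or.inr rfl

/-- A position outside the branch positions lies on a maximal sequence. -/
theorem exists_isMaximalSequence {p : ZMod g} (hB : (branchPositions G v).Nonempty)
    (hp : p ∉ branchPositions G v) :
    ∃ i k q, IsMaximalSequence G v i q ∧ k < q ∧ seqTerm v i k = antipodalOrder v p ∧
      back (branchPositions G v) p = k + 1 ∧ fwd (branchPositions G v) p + k = q ∧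
      2 * i - 1 = p - back (branchPositions G v) p ∧
      2 * i + q = p + fwd (branchPositions G v) p := by
  obtain ⟨s, k, h1, h2, hk, hs, hbk, hfk⟩ := exists_run hB hp
  refine ⟨_, k, _, isMaximalSequence_run hG hg hv h1 h2, hk, ?_, hbk, hfk, ?_, ?_⟩
  · rw [seqTerm_run hg, hs]
  · rw [hbk]
    push_cast
    linear_combination s * two_mul_half hg + hs
  · rw [← hfk]
    push_cast
    linear_combination s * two_mul_half hg + hs

theorem seqTerm_mem {i : ZMod g} {q k : ℕ} (hB : (branchPositions G v).Nonempty)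
    (hQ : IsMaximalSequence G v i q) (hk : k < q) :
    2 * i + (k : ℕ) ∉ branchPositions G v ∧
      back (branchPositions G v) (2 * i + (k : ℕ)) = k + 1 ∧
      fwd (branchPositions G v) (2 * i + (k : ℕ)) + k = q := by
  obtain ⟨h1, h2, rfl⟩ := (isMaximalSequence_iff hG hg hv hB i q).1 hQ
  exact run_add hB h1 hk

omit [Fintype V] [DecidableRel G.Adj] [NeZero g] hG hv in
theorem antipodalOrder_two_mul (j : ZMod g) : antipodalOrder v (2 * j) = v j := by
  unfold antipodalOrder
  congr 1
  linear_combination j * two_mul_half hg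

/-- Leaves meet runs only at their ends, so the condition concerns the parity of the two runs beside
the root. -/
theorem setU_eq : setU G v = antipodalOrder v '' evenPositions (branchPositions G v) := by
  have M := cyclicModel hG hg hv
  ext y
  constructor
  · rintro ⟨⟨j, rfl⟩, hd, hl⟩
    rw [← antipodalOrder_two_mul (v := v) hg] at hd hl ⊢
    have hb : 2 * j ∈ branchPositions G v := hd
    obtain ⟨x, hx, hxb⟩ := M.exists_leaf hb
    refine ⟨2 * j, ⟨hb, fun ho => ?_, fun ho => ?_⟩, rfl⟩
    · rw [← hxb] at ho
      obtain ⟨i, -, hQ, -, hadj⟩ := exists_isMaximalSequence_succ hG hg hv hx (notMem_of_odd_fwd ho)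
      exact (hl x (by rw [leavesAt_eq hG hg hv]; exact ⟨hx, hxb⟩) i _ hQ ho).1 hadj
    · rw [← hxb] at ho
      obtain ⟨i, -, hQ, -, hadj⟩ :=
        exists_isMaximalSequence_pred hG hg hv hx (notMem_of_odd_back ho)
      exact (hl x (by rw [leavesAt_eq hG hg hv]; exact ⟨hx, hxb⟩) i _ hQ ho).2 hadj
  · rintro ⟨b, ⟨hb, ho1, ho2⟩, rfl⟩
    refine ⟨⟨_, rfl⟩, hb, ?_⟩
    rw [leavesAt_eq hG hg hv]
    rintro x ⟨hx, rfl⟩ i q hQ hq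
    have key : ∀ k < q, ¬ (strongResolvingGraph G).Adj x (seqTerm v i k) := by
      intro k hk hadj
      rcases adj_seqTerm_cases hG hg hv ⟨_, hb⟩ hQ hk hx hadj with ⟨-, -, h⟩ | ⟨-, -, h⟩
      · exact ho1 (h ▸ hq)
      · exact ho2 (h ▸ hq)
    have := hq.pos
    exact ⟨key 0 this, key (q - 1) (by omega)⟩

theorem oddLeaves_eq : oddLeaves G v = {x | x ∈ leafSet G ∧
    (Odd (fwd (branchPositions G v) (leafPosition hG.1 v x + 1)) ∨
      Odd (back (branchPositions G v) (leafPosition hG.1 v x - 1)))} := by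
  have M := cyclicModel hG hg hv
  ext x
  constructor
  · rintro ⟨hx, i, q, hQ, hq, k, hk, hadj⟩
    refine ⟨hx, ?_⟩
    rcases adj_seqTerm_cases hG hg hv ⟨_, M.root_mem hx⟩ hQ hk hx hadj with
      ⟨-, -, h⟩ | ⟨-, -, h⟩
    · exact Or.inl (h ▸ hq)
    · exact Or.inr (h ▸ hq)
  · rintro ⟨hx, ho | ho⟩
    · obtain ⟨i, -, hQ, hpos, hadj⟩ :=
        exists_isMaximalSequence_succ hG hg hv hx (notMem_of_odd_fwd ho)
      exact ⟨hx, i, _, hQ, ho, 0, hpos, hadj⟩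
    · obtain ⟨i, -, hQ, hpos, hadj⟩ :=
        exists_isMaximalSequence_pred hG hg hv hx (notMem_of_odd_back ho)
      exact ⟨hx, i, _, hQ, ho, _, by omega, hadj⟩

/-- The k-th term has step counts k + 1 and q - k; for odd q, both are even exactly on A_2. -/
theorem oddAlt_eq (hB : (branchPositions G v).Nonempty) : oddAlt G v =
    {y | ∃ p, p ∉ branchPositions G v ∧ antipodalOrder v p = y ∧
      Even (back (branchPositions G v) p) ∧ Even (fwd (branchPositions G v) p)} := by
  ext y
  constructor
  · rintro ⟨i, q, hQ, hq, k, hk, hk2, rfl⟩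
    obtain ⟨h1, h2, h3⟩ := seqTerm_mem hG hg hv hB hQ hk
    refine ⟨_, h1, (seqTerm_eq hg i k).symm, ?_⟩
    grind
  · rintro ⟨p, hp, rfl, hbk, hfw⟩
    obtain ⟨i, k, q, hQ, hk, hs, h1, h2, -, -⟩ := exists_isMaximalSequence hG hg hv hB hp
    exact ⟨i, q, hQ, by grind, k, hk, by grind, hs⟩

/-- In an even run the two counts have opposite parity. The class containing the end beside `u` is
A_1 if the run follows `u` and A_2 if it precedes `u`. -/
theorem evenAltAt_eq {u : ZMod g} (hu : u ∈ branchPositions G v) :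
    evenAltAt G v (antipodalOrder v u) =
    {y | ∃ p, p ∉ branchPositions G v ∧ antipodalOrder v p = y ∧
      ((Odd (back (branchPositions G v) p) ∧ Even (fwd (branchPositions G v) p) ∧
          p - back (branchPositions G v) p = u) ∨
        (Even (back (branchPositions G v) p) ∧ Odd (fwd (branchPositions G v) p) ∧
          p + fwd (branchPositions G v) p = u))} := by
  have M := cyclicModel hG hg hv
  have hB : (branchPositions G v).Nonempty := ⟨_, hu⟩
  ext y
  constructor
  · rintro ⟨i, q, hQ, hq, r, -, ⟨x, hxu, z, ⟨k', hk', hr', rfl⟩, hadj⟩, k, hk, hr, rfl⟩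
    rw [leavesAt_eq hG hg hv] at hxu
    obtain ⟨hx, rfl⟩ := hxu
    obtain ⟨h1, h2, h3⟩ := seqTerm_mem hG hg hv hB hQ hk
    refine ⟨_, h1, (seqTerm_eq hg i k).symm, ?_⟩
    rcases adj_seqTerm_cases hG hg hv hB hQ hk' hx hadj with ⟨h4, h5, -⟩ | ⟨h4, h5, -⟩
    · refine Or.inl ⟨by grind, by grind, ?_⟩
      rw [h2]
      push_cast
      linear_combination h4
    · refine Or.inr ⟨by grind, by grind, ?_⟩
      rw [← h4, ← h3]
      push_cast
      ring
  · rintro ⟨p, hp, rfl, h⟩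
    obtain ⟨x, hx, rfl⟩ := M.exists_leaf hu
    have hxu : x ∈ leavesAt G v (antipodalOrder v (leafPosition hG.1 v x)) := by
      rw [leavesAt_eq hG hg hv]
      exact ⟨hx, rfl⟩
    obtain ⟨i, k, q, hQ, hk, hs, h1, h2, h3, h4⟩ := exists_isMaximalSequence hG hg hv hB hp
    rcases h with ⟨hbk, hfw, h⟩ | ⟨hbk, hfw, h⟩
    · refine ⟨i, q, hQ, by grind, 1, Or.inl rfl,
        ⟨x, hxu, _, ⟨0, by omega, rfl, rfl⟩, ?_⟩, k, hk, by grind, hs⟩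
      have hm := (seqTerm_mem hG hg hv hB hQ (k := 0) (by omega)).1
      rw [seqTerm_eq hg, M.leaf_adj_iff hx hm]
      left
      push_cast
      linear_combination h3 + h
    · refine ⟨i, q, hQ, by grind, 2, Or.inr rfl,
        ⟨x, hxu, _, ⟨q - 1, by omega, by grind, rfl⟩, ?_⟩, k, hk, by grind, hs⟩
      have hm := (seqTerm_mem hG hg hv hB hQ (k := q - 1) (by omega)).1
      rw [seqTerm_eq hg, M.leaf_adj_iff hx hm]
      right
      rw [Nat.cast_sub (by omega)]
      push_cast
      linear_combination h4 + h

/-- Two sequences on the same side of the root coincide, because doubling is injective. Conversely,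
odd runs on the two sides are different, as a run returning to its root is even. -/
theorem setX_eq : setX G v = {x | x ∈ leafSet G ∧
    Odd (fwd (branchPositions G v) (leafPosition hG.1 v x + 1)) ∧
      Odd (back (branchPositions G v) (leafPosition hG.1 v x - 1))} := by
  have M := cyclicModel hG hg hv
  have h2 := two_mul_half hg
  ext x
  constructor
  · rintro ⟨hx, i, q, i', q', hne, hQ, hq, ⟨k, hk, hadj⟩, hQ', hq', k', hk', hadj'⟩
    have hB : (branchPositions G v).Nonempty := ⟨_, M.root_mem hx⟩
    refine ⟨hx, ?_⟩
    rcases adj_seqTerm_cases hG hg hv hB hQ hk hx hadj with ⟨h3, -, h4⟩ | ⟨h3, -, h4⟩ <;>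
      rcases adj_seqTerm_cases hG hg hv hB hQ' hk' hx hadj' with ⟨h5, -, h6⟩ | ⟨h5, -, h6⟩
    · refine absurd (Prod.ext ?_ (h4.trans h6.symm)) hne
      linear_combination (((g + 1) / 2 : ℕ) : ZMod g) * (h3 - h5) - (i - i') * h2
    · exact ⟨h4 ▸ hq, h6 ▸ hq'⟩
    · exact ⟨h6 ▸ hq', h4 ▸ hq⟩
    · have hqq : q = q' := h4.trans h6.symm
      refine absurd (Prod.ext ?_ hqq) hne
      rw [← hqq] at h5
      linear_combination (((g + 1) / 2 : ℕ) : ZMod g) * (h3 - h5) - (i - i') * h2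
  · rintro ⟨hx, ho1, ho2⟩
    have hB : (branchPositions G v).Nonempty := ⟨_, M.root_mem hx⟩
    obtain ⟨i, hi, hQ, hpos, hadj⟩ :=
      exists_isMaximalSequence_succ hG hg hv hx (notMem_of_odd_fwd ho1)
    obtain ⟨i', hi', hQ', hpos', hadj'⟩ :=
      exists_isMaximalSequence_pred hG hg hv hx (notMem_of_odd_back ho2)
    refine ⟨hx, i, _, i', _, fun heq => ?_, hQ, ho1, ⟨0, hpos, hadj⟩, hQ', ho2,
      _, by omega, hadj'⟩
    refine not_odd_back_of_eq hg hB (u := leafPosition hG.1 v x) ?_ ho2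
    have := congrArg Prod.fst heq
    dsimp only at this
    rw [this] at hi
    linear_combination hi - hi'

/-- The requirement of different roots holds automatically: an odd run cannot have the same position
at both ends. -/
theorem oddAltBetweenX_eq (hB : (branchPositions G v).Nonempty) : oddAltBetweenX G v =
    {y | ∃ p, p ∉ branchPositions G v ∧ antipodalOrder v p = y ∧
      Even (back (branchPositions G v) p) ∧ Even (fwd (branchPositions G v) p) ∧
      Odd (back (branchPositions G v) (p - back (branchPositions G v) p - 1)) ∧
      Odd (fwd (branchPositions G v) (p + fwd (branchPositions G v) p + 1))} := by
  have M := cyclicModel hG hg hv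
  ext y
  unfold oddAltBetweenX
  rw [setX_eq hG hg hv]
  constructor
  · rintro ⟨i, q, hQ, hq, ⟨x₁, ⟨hx₁, -, ho₁⟩, x₂, ⟨hx₂, ho₂, -⟩, ha₁, ha₂, -⟩, k, hk, hk2, rfl⟩
    obtain ⟨h1, h2, h3⟩ := seqTerm_mem hG hg hv hB hQ hk
    refine ⟨_, h1, (seqTerm_eq hg i k).symm, by grind, by grind, ?_, ?_⟩
    · rcases adj_seqTerm_cases hG hg hv hB hQ (k := 0) (by omega) hx₁ ha₁.symm with
        ⟨h4, -, -⟩ | ⟨-, h5, -⟩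
      · convert ho₁ using 3
        rw [h2]
        push_cast
        linear_combination h4
      · omega
    · rcases adj_seqTerm_cases hG hg hv hB hQ (k := q - 1) (by omega) hx₂ ha₂.symm with
        ⟨-, h5, -⟩ | ⟨h4, -, -⟩
      · omega
      · convert ho₂ using 3
        rw [← h4, ← h3]
        push_cast
        ring
  · rintro ⟨p, hp, rfl, hbk, hfw, ho₁, ho₂⟩
    obtain ⟨i, k, q, hQ, hk, hs, h1, h2, h3, h4⟩ := exists_isMaximalSequence hG hg hv hB hp
    obtain ⟨x₁, hx₁, hp₁⟩ := M.exists_leaf (back_mem hB p)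
    obtain ⟨x₂, hx₂, hp₂⟩ := M.exists_leaf (fwd_mem hB p)
    have hq : Odd q := by grind
    obtain ⟨hm1, hm2, hm3⟩ := seqTerm_mem hG hg hv hB hQ (k := 0) (by omega)
    obtain ⟨hn1, hn2, hn3⟩ := seqTerm_mem hG hg hv hB hQ (k := q - 1) (by omega)
    have e1 : leafPosition hG.1 v x₁ + 1 = 2 * i + (0 : ℕ) := by
      push_cast
      linear_combination hp₁ - h3
    have e2 : leafPosition hG.1 v x₂ - 1 = 2 * i + (q - 1 : ℕ) := by
      rw [Nat.cast_sub (by omega)]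
      push_cast
      linear_combination hp₂ - h4
    refine ⟨i, q, hQ, hq, ⟨x₁, ⟨hx₁, ?_, by rwa [hp₁]⟩, x₂, ⟨hx₂, by rwa [hp₂], ?_⟩, ?_, ?_, ?_⟩,
      k, hk, by grind, hs⟩
    · rw [e1]
      grind
    · rw [e2]
      grind
    · rw [seqTerm_eq hg]
      exact ((M.leaf_adj_iff hx₁ hm1).2 (Or.inl e1.symm)).symm
    · rw [seqTerm_eq hg]
      exact ((M.leaf_adj_iff hx₂ hn1).2 (Or.inr e2.symm)).symm
    · rintro ⟨j, hj₁, hj₂⟩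
      have h5 : leafPosition hG.1 v x₁ = leafPosition hG.1 v x₂ := by
        unfold leafPosition
        rw [root_eq hG hv hj₁.2, root_eq hG hv hj₂.2]
      refine not_odd_fwd_of_eq hg hB (u := leafPosition hG.1 v x₁) ?_ ?_
      · rw [e1]
        have : fwd (branchPositions G v) (2 * i + (0 : ℕ)) = q := by omega
        rw [this]
        push_cast
        linear_combination h4 - hp₂ - h5
      · rw [e1]
        grind

theorem strongBasisForced_of_mem_evenPositions {u b : ZMod g}
    (hu : u ∈ evenPositions (branchPositions G v)) (hb : b ∈ branchPositions G v) (hne : b ≠ u) :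
    strongBasisForced G = oddLeaves G v ∪ oddAlt G v ∪
      {y | ∃ p, p ∉ branchPositions G v ∧ antipodalOrder v p = y ∧
      ((Odd (back (branchPositions G v) p) ∧ Even (fwd (branchPositions G v) p) ∧
          ∀ u ∈ evenPositions (branchPositions G v), p - back (branchPositions G v) p = u) ∨
        (Even (back (branchPositions G v) p) ∧ Odd (fwd (branchPositions G v) p) ∧
          ∀ u ∈ evenPositions (branchPositions G v), p + fwd (branchPositions G v) p = u))} := by
  have hB : (branchPositions G v).Nonempty := ⟨_, hb⟩
  ext x
  rw [mem_strongBasisForced_iff hG.1,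
    (cyclicModel hG hg hv).forced_iff_of_mem_evenPositions hu hb hne, oddLeaves_eq hG hg hv,
    oddAlt_eq hG hg hv hB, Set.union_assoc]
  refine or_congr Iff.rfl ?_
  constructor
  · rintro ⟨p, hp, hx, h | h⟩
    · exact Or.inl ⟨p, hp, hx, h⟩
    · exact Or.inr ⟨p, hp, hx, h⟩
  · rintro (⟨p, hp, hx, h⟩ | ⟨p, hp, hx, h⟩)
    · exact ⟨p, hp, hx, Or.inl h⟩
    · exact ⟨p, hp, hx, Or.inr h⟩

theorem evenPositions_of_setU_eq {u : V} (h : setU G v = {u}) :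
    ∃ b, evenPositions (branchPositions G v) = {b} ∧ antipodalOrder v b = u := by
  have hinj := (cyclicModel hG hg hv).injective
  rw [setU_eq hG hg hv] at h
  have hu : u ∈ antipodalOrder v '' evenPositions (branchPositions G v) := by rw [h]; rfl
  obtain ⟨b, hb, rfl⟩ := hu
  refine ⟨b, ?_, rfl⟩
  rw [← Set.image_singleton] at h
  exact hinj.image_injective h

end Translation

end OddUnicyclic

-- The three cases

open OddUnicyclic
theorem mainTheorem8 {V : Type*} [Fintype V] (G : SimpleGraph V) [DecidableRel G.Adj]
    (hG : IsUnicyclic G) (g : ℕ) (hg : Odd g) (v : ZMod g → V) (hv : IsCycleLabelling G g v) :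
    -- (i)
    ((2 ≤ (setU G v).ncard ∨
        ∃ u, setU G v = {u} ∧ ∀ x ∈ leavesAt G v u, ∀ i q, IsMaximalSequence G v i q →
          ¬ AdjToSequence G v x i q) →
      strongBasisForced G = oddLeaves G v ∪ oddAlt G v) ∧
    -- (ii)
    (∀ u, setU G v = {u} →
      (∃ x ∈ leavesAt G v u, ∃ i q, IsMaximalSequence G v i q ∧ Even q ∧
        AdjToSequence G v x i q) →
      (∃ j : ZMod g, v j ≠ u ∧ 3 ≤ G.degree (v j)) →
      strongBasisForced G = oddLeaves G v ∪ oddAlt G v ∪ evenAltAt G v u) ∧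
    -- (iii)
    (setU G v = ∅ → strongBasisForced G = setX G v ∪ oddAltBetweenX G v) := by
  have hg3 := hv.1
  have : NeZero g := ⟨by omega⟩
  have M := cyclicModel hG hg hv
  refine ⟨?_, ?_, ?_⟩
  · rintro (h | ⟨u, hu, hl⟩)
    · rw [setU_eq hG hg hv, Set.ncard_image_of_injective _ M.injective] at h
      obtain ⟨u, u', hu, hu', hne⟩ := (Set.one_lt_ncard_iff).1 h
      rw [strongBasisForced_of_mem_evenPositions hG hg hv hu hu'.1 hne.symm, Set.union_eq_left]
      -- A run has one start and one end, so it cannot be bounded on the given side by two different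
      -- elements of `U`.
      rintro y ⟨p, -, -, ⟨-, -, h⟩ | ⟨-, -, h⟩⟩
      · exact absurd ((h u hu).symm.trans (h u' hu')) hne
      · exact absurd ((h u hu).symm.trans (h u' hu')) hne
    · obtain ⟨b, hb, rfl⟩ := evenPositions_of_setU_eq hG hg hv hu
      have hbU : b ∈ evenPositions (branchPositions G v) := by rw [hb]; rfl
      obtain ⟨x, hx, rfl⟩ := M.exists_leaf hbU.1
      have hxl : x ∈ leavesAt G v (antipodalOrder v (leafPosition hG.1 v x)) := by
        rw [leavesAt_eq hG hg hv]
        exact ⟨hx, rfl⟩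
      -- Both positions beside the root lie in `B`. One serves as the required second element of
      -- `B`, and together they leave no run beside the root.
      have h1 : leafPosition hG.1 v x + 1 ∈ branchPositions G v := by
        by_contra h
        obtain ⟨i, -, hQ, hpos, hadj⟩ := exists_isMaximalSequence_succ hG hg hv hx h
        exact hl x hxl i _ hQ ⟨0, hpos, hadj⟩
      have h2 : leafPosition hG.1 v x - 1 ∈ branchPositions G v := by
        by_contra h
        obtain ⟨i, -, hQ, hpos, hadj⟩ := exists_isMaximalSequence_pred hG hg hv hx h
        exact hl x hxl i _ hQ ⟨_, by omega, hadj⟩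
      have hB : (branchPositions G v).Nonempty := ⟨_, h1⟩
      rw [strongBasisForced_of_mem_evenPositions hG hg hv hbU h1 (fun h => by
        refine natCast_ne_zero_of_lt (g := g) (n := 1) (by omega) (by omega) ?_
        push_cast
        linear_combination h), Set.union_eq_left]
      rintro y ⟨p, hp, -, ⟨-, -, h⟩ | ⟨-, -, h⟩⟩
      · have h := h _ hbU
        obtain ⟨s, k, -, h4, hk, rfl, h5, -⟩ := exists_run hB hp
        rw [h5] at h
        push_cast at h
        rw [show leafPosition hG.1 v x + 1 = s by linear_combination -h] at h1
        exact absurd h1 h4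
      · have h := h _ hbU
        obtain ⟨s, k, h3, -, hk, rfl, -, h6⟩ := exists_run hB hp
        have h7 := (run_add hB h3 (k := fwd (branchPositions G v) s - 1) (by omega)).1
        rw [Nat.cast_sub (by omega), ← h6] at h7
        push_cast at h7
        refine absurd ?_ h7
        convert h2 using 1
        linear_combination h
  · rintro u hu - ⟨j, hj, hd⟩
    obtain ⟨b, hb, rfl⟩ := evenPositions_of_setU_eq hG hg hv hu
    have hbU : b ∈ evenPositions (branchPositions G v) := by rw [hb]; rfl
    rw [← antipodalOrder_two_mul (v := v) hg] at hj hd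
    rw [strongBasisForced_of_mem_evenPositions hG hg hv hbU (b := 2 * j) hd
      (fun h => hj (by rw [h])), evenAltAt_eq hG hg hv hbU.1]
    -- As `U` is a singleton, the condition over all its elements is the one describing `evenAltAt`.
    simp only [hb, Set.mem_singleton_iff, forall_eq]
  · intro hU
    rw [setU_eq hG hg hv, Set.image_eq_empty] at hU
    -- Without vertices of degree at least 3 there are no leaves, so the right side is empty; by
    -- rotation no vertex is forced.
    rcases (branchPositions G v).eq_empty_or_nonempty with hB | hB
    · have hleaf : ∀ x, x ∉ leafSet G := fun x hx => by
        have := M.root_mem hx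
        rw [hB] at this
        exact this
      have hX : setX G v = ∅ := Set.eq_empty_of_forall_notMem fun x hx => hleaf x hx.1
      have hA : oddAltBetweenX G v = ∅ := by
        refine Set.eq_empty_of_forall_notMem ?_
        rintro y ⟨i, q, -, -, ⟨x, hx, -⟩, -⟩
        rw [hX] at hx
        exact hx
      rw [hX, hA, Set.union_self]
      refine Set.eq_empty_of_forall_notMem fun x hx => ?_
      rw [hB] at M
      obtain ⟨I, hI, hxI⟩ := M.exists_maximum_of_eq_empty x
      exact (mem_strongBasisForced_iff hG.1 x).1 hx I hI hxI
    · ext x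
      rw [mem_strongBasisForced_iff hG.1, M.forced_iff_of_evenPositions_eq_empty hg hB hU,
        setX_eq hG hg hv, oddAltBetweenX_eq hG hg hv hB]
      rfl
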